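/- **Setting.** Let $n\ge 1$, $m\ge 0$, $Q\in\mathbb R^{n\times n}$ symmetric positive semidefinite, $c\in\mathbb R^n$, $A\in\mathbb R^{m\times n}$, $b\in\mathbb R^m$, $\mathrm{tol}>0$. Write $z=(x,\lambda,\mu_L,\mu_R)\in\mathbb R^{N}$, $N=3n+m$, let $e$ be the all-ones vector, and let products of vectors be componentwise. For $\omega,\tau>0$ put $$F_\tau(z)=\begin{pmatrix}Qx+\omega x+c-A^{T}\lambda-\mu_L+\mu_R\\ Ax-b+\omega\lambda\\ \mu_L(e+x)-\tau e\\ \mu_R(e-x)-\tau e\end{pmatrix},\qquad DF(z)=\begin{bmatrix}Q+\omega I&-A^{T}&-I&I\\ A&\omega I&0&0\\ \operatorname{diag}(\mu_L)&0&\operatorname{diag}(e+x)&0\\ -\operatorname{diag}(\mu_R)&0&0&\operatorname{diag}(e-x)\end{bmatrix}.$$ Let $\mathcal N(\tau)$ be the set of $z$ with $F_\tau(z)=(0,0,r_3,r_4)$, $\|(r_3,r_4)\|_2\le\theta\tau$, $\|x\|_\infty<1$, $\mu_L,\mu_R>0$; let $\mathcal N_h(\tau)$ be the same set with $\theta$ replaced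 by $\theta/2$; and let $\mathcal N(\tau,\nu)$, $\mathcal N_h(\tau,\nu)$ be the sets of points at Euclidean distance at most $\nu$ from some point of $\mathcal N(\tau)$, $\mathcal N_h(\tau)$. **Method parameters.** Let the parameters satisfy (norms of matrices are spectral norms unless marked $F$ for Frobenius) $0<\beta\le\theta\le 0.3$, $1-\beta/\sqrt{2n}\le\sigma<1$, $C_q\ge\|Q\|n+\|c\|\sqrt n$, $\omega\le\min\{\frac{\mathrm{tol}}{2n},\frac{\mathrm{tol}^2}{16(4C_q+n)},1\}$, $C_\lambda\ge(\|A\|\sqrt n+\|b\|)/\omega$, $C_{\Delta\mu}\ge(\omega+\|Q\|)\sqrt n+\|c\|+\|A^T\|C_\lambda$, $\tau_A\ge\max\{\frac14\|Q+\omega I+\frac1\omega A^TA\|,\,4\|c-\frac1\omega A^Tb\|\}$, $\tau_E\le\frac{\mathrm{tol}^2\omega}{48n\max\{\|A\|,C_q\}}$, $C_\mu\ge\sqrt{2n}\,(C_{\Delta\mu}+(1+\theta)\tau_A)$, $C_z\ge\sqrt{n+C_\lambda^2+C_\mu^2}+0.1$, $c_{gap}\le\frac12\frac{1-\theta}{1+C_z}\sigma\tau_E$,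 $C_{DF}\ge\|Q\|+2\omega+2\|A\|_F+4+4C_z$, $C_{DFinv}\ge\frac1{c_{gap}}\max\{\frac1\omega,\frac{C_z}{c_{gap}}\}$, $\kappa_{DF}\ge C_{DF}C_{DFinv}$, $C_{\delta F}\ge C_{DF}$, $C_{\delta DF}\ge2$, $C_{\delta\Delta z}\ge2\kappa_{DF}$, $C_\nu\ge\max\{2C_{\delta\Delta z}(C_{\delta F}C_{DFinv}+\frac2\omega C_{\delta DF}C_z),\,1+C_{DFinv}C_{\delta F}\}$, $\nu_2\le\min\{0.1,\frac{c_{gap}}{C_\nu},\frac{\omega}{2C_{\delta DF}\kappa_{DF}},\frac{\theta\sigma\tau_E}{2C_\nu C_{\delta F}}\}$, $\nu_1\le\nu_2/C_\nu$, $\nu_0\le\min\{\nu_1/C_\nu,\frac{\mathrm{tol}}{2\max\{\|A\|,C_q\}}\}$, where $C_q,\omega,\tau_E,c_{gap},\nu_0,\nu_1,\nu_2$ are also positive. **Floating-point arithmetic.** With unit roundoff $\epsilon_{mach}>0$, storing a problem datum ($Q,c,A,b$) and every elementary operation on machine numbers commits a relative error of at most $\epsilon_{mach}$ (no overflow or underflow);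 sums may be accumulated in any order. A linear solver is *stable with constant $\gamma$* if, for every $\epsilon_{mach}>0$ and every system $Gy=v$ with $G$ regular and $\gamma\epsilon_{mach}\|G\|\|G^{-1}\|<1$, the computed solution $\hat y$ satisfies $\|\hat y-y\|_2\le\gamma\epsilon_{mach}\|y\|_2$ for some $y,\delta G,\delta v$ with $(G+\delta G)y=v+\delta v$, $\|\delta G\|\le\gamma\epsilon_{mach}\|G\|$, $\|\delta v\|_2\le\gamma\epsilon_{mach}\|v\|_2$ (backward stable solvers are the case $y=\hat y$). **Theorem (Centrality step).** For all $n,m,\gamma$ there is a constant $C>0$, depending on $n,m,\gamma$ only, such that the following holds for all data, tolerances and method parameters as above, every linear solver that is stable with constant $\gamma$, and every unit roundoff $\epsilon_{mach}>0$ that is so small that $$C\cdot\epsilon_{mach}\le\frac{\nu_0}{4\,C_z\,\kappa_{DF}}.$$ Let $\hat\tau\in[\sigma\tau_E,\sigma\tau_A]$ and $\tilde z\in\mathcal N(\hat\tau,\nu_1)$. Then $DF(\tilde z)$ is regular, and whenever the Newton step $$DF(\tilde z)\,\Delta\tilde z=-F_{\hat\tau}(\tilde z),\qquad \hat{\tilde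 z}:=\tilde z+\Delta\tilde z$$ is carried out in floating-point arithmetic with unit roundoff $\epsilon_{mach}$ (storing the data, evaluating $DF(\tilde z)$ and $F_{\hat\tau}(\tilde z)$, solving with the given solver, and forming the sum), the computed vector satisfies $\hat{\tilde z}\in\mathcal N_h(\hat\tau,\nu_2)$. -/

import Mathlib

open scoped Matrix Matrix.Norms.L2Operator

noncomputable section

namespace BoxQP

/-- Data of the problem: minimize `1/2 * xᵀ Q x + cᵀ x` over the box `‖x‖_∞ ≤ 1` subject to
minimality of `‖A x - b‖₂`. -/
structure ProblemData (n m : ℕ) where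
  Q : Matrix (Fin n) (Fin n) ℝ
  c : EuclideanSpace ℝ (Fin n)
  A : Matrix (Fin m) (Fin n) ℝ
  b : EuclideanSpace ℝ (Fin m)

/-- Index set of the primal-dual variable `z = (x, lam, muL, muR)`; it has `3 * n + m` elements. -/
abbrev Idx (n m : ℕ) : Type := Fin n ⊕ Fin m ⊕ Fin n ⊕ Fin n

/-- The primal-dual space `ℝ^(3n+m)` with its Euclidean norm. -/
abbrev PDSpace (n m : ℕ) : Type := EuclideanSpace ℝ (Idx n m)

variable {n m : ℕ}

/-- Position of `x i` in `z`. -/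
abbrev ixX (i : Fin n) : Idx n m := Sum.inl i
/-- Position of `lam k` in `z`. -/
abbrev ixLam (k : Fin m) : Idx n m := Sum.inr (Sum.inl k)
/-- Position of `muL i` in `z`. -/
abbrev ixL (i : Fin n) : Idx n m := Sum.inr (Sum.inr (Sum.inl i))
/-- Position of `muR i` in `z`. -/
abbrev ixR (i : Fin n) : Idx n m := Sum.inr (Sum.inr (Sum.inr i))

/-- The block `x` of `z`. -/
def xPart (z : PDSpace n m) : Fin n → ℝ := fun i => z (ixX i)
/-- The block `lam` of `z`. -/
def lamPart (z : PDSpace n m) : Fin m → ℝ := fun k => z (ixLam k)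
/-- The block `muL` of `z`. -/
def muLPart (z : PDSpace n m) : Fin n → ℝ := fun i => z (ixL i)
/-- The block `muR` of `z`. -/
def muRPart (z : PDSpace n m) : Fin n → ℝ := fun i => z (ixR i)

/-- The optimality function `F_τ` (with regularization parameter `ω`). -/
def optF (P : ProblemData n m) (ω τ : ℝ) (z : PDSpace n m) : PDSpace n m :=
  WithLp.toLp 2 (Sum.elim
    (fun i => (P.Q *ᵥ xPart z) i + ω * xPart z i + P.c i - (P.Aᵀ *ᵥ lamPart z) i
      - muLPart z i + muRPart z i)
    (Sum.elim
      (fun k => (P.A *ᵥ xPart z) k - P.b k + ω * lamPart z k)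
      (Sum.elim
        (fun i => muLPart z i * (1 + xPart z i) - τ)
        (fun i => muRPart z i * (1 - xPart z i) - τ))))

/-- The Jacobian `DF` of `F_τ`; it does not depend on `τ`. The block columns and block rows are
ordered as `x, lam, muL, muR`. -/
def jacF (P : ProblemData n m) (ω : ℝ) (z : PDSpace n m) : Matrix (Idx n m) (Idx n m) ℝ :=
  Matrix.fromBlocks
    (P.Q + ω • (1 : Matrix (Fin n) (Fin n) ℝ))
    (Matrix.fromCols (-P.Aᵀ) (Matrix.fromCols (-1) 1))
    (Matrix.fromRows P.A
      (Matrix.fromRows (Matrix.diagonal (muLPart z)) (-Matrix.diagonal (muRPart z))))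
    (Matrix.fromBlocks (ω • (1 : Matrix (Fin m) (Fin m) ℝ)) 0 0
      (Matrix.fromBlocks
        (Matrix.diagonal fun i => 1 + xPart z i) 0 0 (Matrix.diagonal fun i => 1 - xPart z i)))

/-- The neighbourhood of relative width `w` of the central path at `τ`: the first two blocks of
`F_τ(z)` vanish, the last two satisfy `‖(r₃, r₄)‖₂ ≤ w * τ`, and `z` is strictly interior. -/
def pathNbhd (P : ProblemData n m) (ω w τ : ℝ) : Set (PDSpace n m) :=
  {z | (∀ i, optF P ω τ z (ixX i) = 0) ∧
    (∀ k, optF P ω τ z (ixLam k) = 0) ∧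
    ‖(WithLp.toLp 2 (Sum.elim (fun i => optF P ω τ z (ixL i)) (fun i => optF P ω τ z (ixR i))) :
      EuclideanSpace ℝ (Fin n ⊕ Fin n))‖ ≤ w * τ ∧
    (∀ i, |xPart z i| < 1) ∧ (∀ i, 0 < muLPart z i) ∧ (∀ i, 0 < muRPart z i)}

/-- The envelope of radius `ν` of a set. -/
def envelope (S : Set (PDSpace n m)) (ν : ℝ) : Set (PDSpace n m) :=
  {z' | ∃ z ∈ S, ‖z' - z‖ ≤ ν}

/-- Frobenius norm of a matrix (`‖A‖` denotes the spectral norm). -/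
def frobNorm (A : Matrix (Fin m) (Fin n) ℝ) : ℝ := Real.sqrt (∑ k, ∑ i, A k i ^ 2)

/-- The scalar method parameters that concern the primal-dual Newton steps. -/
structure MethodParams where
  θ : ℝ
  β : ℝ
  σ : ℝ
  Cq : ℝ
  ω : ℝ
  Clam : ℝ
  CΔμ : ℝ
  τA : ℝ
  τE : ℝ
  Cμ : ℝ
  Cz : ℝ
  cGap : ℝ
  CDF : ℝ
  CDFinv : ℝ
  κDF : ℝ
  CδF : ℝ
  CδDF : ℝ
  CδΔz : ℝ
  Cν : ℝ
  ν₂ : ℝ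
  ν₁ : ℝ
  ν₀ : ℝ

/-- The rules by which the method parameters are computed from `Q, c, A, b` and the tolerance
`tol`. Each parameter is its formula rounded in a prescribed direction, whence the inequalities;
all parameters are positive and the reduction factor `σ` is below `1`. -/
structure MethodParams.Admissible (p : MethodParams) (P : ProblemData n m) (tol : ℝ) : Prop where
  θ_pos : 0 < p.θ
  θ_le : p.θ ≤ 3 / 10
  β_pos : 0 < p.β
  β_le : p.β ≤ p.θ
  σ_lt : p.σ < 1
  σ_ge : 1 - p.β / Real.sqrt (2 * n) ≤ p.σ
  Cq_pos : 0 < p.Cq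
  Cq_ge : ‖P.Q‖ * n + ‖P.c‖ * Real.sqrt n ≤ p.Cq
  ω_pos : 0 < p.ω
  ω_le : p.ω ≤ min (min (tol / (2 * n)) (tol ^ 2 / (4 * p.Cq + n) * (1 / 16))) 1
  Clam_ge : (‖P.A‖ * Real.sqrt n + ‖P.b‖) / p.ω ≤ p.Clam
  CΔμ_ge : (p.ω + ‖P.Q‖) * Real.sqrt n + ‖P.c‖ + ‖P.Aᵀ‖ * p.Clam ≤ p.CΔμ
  τA_ge : max
      (‖P.Q + p.ω • (1 : Matrix (Fin n) (Fin n) ℝ) + (1 / p.ω) • (P.Aᵀ * P.A)‖ / 4)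
      (4 * ‖P.c - (1 / p.ω) • (WithLp.toLp 2 (P.Aᵀ *ᵥ P.b.ofLp) : EuclideanSpace ℝ (Fin n))‖)
    ≤ p.τA
  τE_pos : 0 < p.τE
  τE_le : p.τE ≤ tol ^ 2 * p.ω / (48 * n * max ‖P.A‖ p.Cq)
  Cμ_ge : Real.sqrt (2 * n) * (p.CΔμ + (1 + p.θ) * p.τA) ≤ p.Cμ
  Cz_ge : Real.sqrt (n + p.Clam ^ 2 + p.Cμ ^ 2) + 1 / 10 ≤ p.Cz
  cGap_pos : 0 < p.cGap
  cGap_le : p.cGap ≤ (1 - p.θ) / (1 + p.Cz) * p.σ * p.τE * (1 / 2)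
  CDF_ge : ‖P.Q‖ + 2 * p.ω + 2 * frobNorm P.A + 4 + 4 * p.Cz ≤ p.CDF
  CDFinv_ge : 1 / p.cGap * max (1 / p.ω) (p.Cz / p.cGap) ≤ p.CDFinv
  κDF_ge : p.CDF * p.CDFinv ≤ p.κDF
  CδF_ge : p.CDF ≤ p.CδF
  CδDF_ge : 2 ≤ p.CδDF
  CδΔz_ge : 2 * p.κDF ≤ p.CδΔz
  Cν_ge : max (2 * p.CδΔz * (p.CδF * p.CDFinv + 2 / p.ω * p.CδDF * p.Cz))
      (1 + p.CDFinv * p.CδF) ≤ p.Cν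
  ν₂_pos : 0 < p.ν₂
  ν₂_le : p.ν₂ ≤ min (min (1 / 10) (p.cGap / p.Cν))
      (min (p.ω / (2 * p.CδDF * p.κDF)) (p.θ * p.σ * p.τE / (2 * p.Cν * p.CδF)))
  ν₁_pos : 0 < p.ν₁
  ν₁_le : p.ν₁ ≤ p.ν₂ / p.Cν
  ν₀_pos : 0 < p.ν₀
  ν₀_le : p.ν₀ ≤ min (p.ν₁ / p.Cν) (tol / (2 * max ‖P.A‖ p.Cq))

/-- `𝒩(τ, ν)`. -/
def envN (P : ProblemData n m) (p : MethodParams) (τ ν : ℝ) : Set (PDSpace n m) :=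
  envelope (pathNbhd P p.ω p.θ τ) ν

/-- `𝒩_h(τ, ν)`, the enveloped neighbourhood of half the width. -/
def envNh (P : ProblemData n m) (p : MethodParams) (τ ν : ℝ) : Set (PDSpace n m) :=
  envelope (pathNbhd P p.ω (1 / 2 * p.θ) τ) ν

/-! ### Floating point arithmetic

The standard model with unit roundoff `u` (no overflow or underflow): storing a real number, and
each elementary operation on machine numbers, commits a relative error of at most `u`. The
definitions below are relations, so that a statement about all outcomes covers each rounding
mode, and each order in which a sum is accumulated. -/

/-- `y` is an admissible floating point result for the exact value `x`. -/
def Rounds (u x y : ℝ) : Prop := |y - x| ≤ u * |x|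

/-- `y` is an admissible floating point value of the sum of a nonempty multiset of machine
numbers, added up pairwise in an arbitrary order. -/
inductive FlSum (u : ℝ) : Multiset ℝ → ℝ → Prop
  | single (x : ℝ) : FlSum u {x} x
  | add {s t : Multiset ℝ} {a b y : ℝ} :
      FlSum u s a → FlSum u t b → Rounds u (a + b) y → FlSum u (s + t) y

/-- `P'` is the problem data `P` as stored on the machine. -/
structure StoredData (u : ℝ) (P P' : ProblemData n m) : Prop where
  Q : ∀ i j, Rounds u (P.Q i j) (P'.Q i j)
  c : ∀ i, Rounds u (P.c i) (P'.c i)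
  A : ∀ k i, Rounds u (P.A k i) (P'.A k i)
  b : ∀ k, Rounds u (P.b k) (P'.b k)

/-- `J` is a floating point evaluation of `DF(z)` from stored data. Each entry of `DF(z)` is a
machine number, up to sign, or one sum of two machine numbers. -/
def FlJac (u : ℝ) (P : ProblemData n m) (ω : ℝ) (z : PDSpace n m)
    (J : Matrix (Idx n m) (Idx n m) ℝ) : Prop :=
  ∀ a b, Rounds u (jacF P ω z a b) (J a b)

/-- `r` is a floating point evaluation of `F_τ(z)` from stored data. -/
structure FlResidual (u : ℝ) (P : ProblemData n m) (ω τ : ℝ) (z r : PDSpace n m) : Prop where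
  row_x : ∀ i, ∃ (p : Fin n → ℝ) (q : Fin m → ℝ) (w : ℝ),
    (∀ j, Rounds u (P.Q i j * xPart z j) (p j)) ∧
    (∀ k, Rounds u (P.A k i * lamPart z k) (q k)) ∧
    Rounds u (ω * xPart z i) w ∧
    FlSum u (Finset.univ.val.map p + Finset.univ.val.map (fun k => -q k)
      + {w, P.c i, -muLPart z i, muRPart z i}) (r (ixX i))
  row_lam : ∀ k, ∃ (p : Fin n → ℝ) (w : ℝ),
    (∀ j, Rounds u (P.A k j * xPart z j) (p j)) ∧
    Rounds u (ω * lamPart z k) w ∧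
    FlSum u (Finset.univ.val.map p + {w, -P.b k}) (r (ixLam k))
  row_L : ∀ i, ∃ s t : ℝ, Rounds u (1 + xPart z i) s ∧ Rounds u (muLPart z i * s) t ∧
    Rounds u (t - τ) (r (ixL i))
  row_R : ∀ i, ∃ s t : ℝ, Rounds u (1 - xPart z i) s ∧ Rounds u (muRPart z i * s) t ∧
    Rounds u (t - τ) (r (ixR i))

/-- A solver for linear systems: `solve u G v` is the vector computed for `G * y = v` on a machine
with unit roundoff `u`. -/
abbrev LinSolver (n m : ℕ) : Type :=
  ℝ → Matrix (Idx n m) (Idx n m) ℝ → PDSpace n m → PDSpace n m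

/-- The solver is numerically stable with constant `γ`: for each regular system that is not
numerically singular, it computes nearly the right answer to nearly the right system, with
relative errors of at most `γ * u` in the 2-norm. Backward stability is the case
`y = solve u G v`. -/
def LinSolver.IsStable (γ : ℝ) (solve : LinSolver n m) : Prop :=
  ∀ (u : ℝ) (G : Matrix (Idx n m) (Idx n m) ℝ) (v : PDSpace n m),
    0 < u → IsUnit G.det → γ * u * (‖G‖ * ‖G⁻¹‖) < 1 →
    ∃ (δG : Matrix (Idx n m) (Idx n m) ℝ) (δv y : PDSpace n m),
      ‖δG‖ ≤ γ * u * ‖G‖ ∧ ‖δv‖ ≤ γ * u * ‖v‖ ∧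
      (G + δG) *ᵥ y.ofLp = (v + δv).ofLp ∧
      ‖solve u G v - y‖ ≤ γ * u * ‖y‖

/-- `z'` is a floating point outcome of the Newton step for `F_τ` at `z`: the data are stored,
`DF(z)` and `F_τ(z)` are evaluated, the system `DF(z) * Δz = -F_τ(z)` is passed to the solver, and
`z + Δz` is formed, all of it with unit roundoff `u`. -/
def FlNewtonStep (solve : LinSolver n m) (u : ℝ) (P : ProblemData n m) (ω τ : ℝ)
    (z z' : PDSpace n m) : Prop :=
  ∃ (P' : ProblemData n m) (J : Matrix (Idx n m) (Idx n m) ℝ) (r : PDSpace n m),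
    StoredData u P P' ∧ FlJac u P' ω z J ∧ FlResidual u P' ω τ z r ∧
    ∀ a, Rounds u (z a + solve u J (-r) a) (z' a)

end BoxQP

end

/-! The exact Newton step maps 𝒩(τ) into 𝒩_h(τ); everything else is perturbation theory around that
fact.

Exact step (`newton_mem_pathNbhd_half`): the first two blocks of F_τ are affine, so a full step
keeps them zero, while the linear terms cancel in the last two blocks and leave exactly the products
dx·dμL and -dx·dμR. Skew symmetry of the A-blocks and Q ⪰ 0 make the sum of these products
nonnegative, and then AM-GM bounds the sum of their absolute values by ‖(r₃, r₄)‖² / (2(1-θ)τ) ≤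
θτ/2. That is the halved width, and it also keeps the iterate interior.

Stability: points of 𝒩(τ) have norm at most Cz - 1/10, and their slacks and multipliers are at least
2·cGap (`norm_le_of_mem`, `gap_of_mem`). Near such points, dividing the complementarity rows by the
multipliers gives DF a coercive quadratic form, hence ‖DF⁻¹‖ ≤ CDFinv (`jacF_bounded_below`). Since
F_τ is quadratic, the exact steps from z and from a companion z₀ in 𝒩(τ) at distance at most ν₁ lead
to points at most ν₂/2 apart.

Rounding: the errors in matrix, right-hand side, solver and final sum perturb the step by at most a
constant in n, m, γ times the unit roundoff, the condition bound CDF·CDFinv and Cz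
(`norm_flNewtonStep_sub_le`). By the choice of the roundoff this is at most ν₀/4, which fits into
the other half of ν₂. -/

noncomputable section

namespace BoxQP

/-! ### Euclidean and spectral norm estimates, lower bounds for matrices. -/

section Generic

variable {ι κ : Type*} [Fintype κ]

/-- The product of a matrix and a vector as a map between Euclidean spaces. -/
def mv (G : Matrix ι κ ℝ) (v : EuclideanSpace ℝ κ) : EuclideanSpace ℝ ι :=
  WithLp.toLp 2 (G *ᵥ v.ofLp)

@[simp] lemma mv_apply (G : Matrix ι κ ℝ) (v : EuclideanSpace ℝ κ) (i : ι) :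
    mv G v i = (G *ᵥ v.ofLp) i := rfl

lemma mv_sub (G : Matrix ι κ ℝ) (v w : EuclideanSpace ℝ κ) : mv G (v - w) = mv G v - mv G w := by
  ext i; simp [mv, Matrix.mulVec_sub]

lemma mv_add_left (G H : Matrix ι κ ℝ) (v : EuclideanSpace ℝ κ) :
    mv (G + H) v = mv G v + mv H v := by
  ext i; simp [mv, Matrix.add_mulVec]

lemma mv_sub_left (G H : Matrix ι κ ℝ) (v : EuclideanSpace ℝ κ) :
    mv (G - H) v = mv G v - mv H v := by
  ext i; simp [mv, Matrix.sub_mulVec]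

variable [Fintype ι]

lemma abs_apply_le_norm (v : EuclideanSpace ℝ ι) (i : ι) : |v i| ≤ ‖v‖ := by
  simpa using PiLp.norm_apply_le v i

lemma norm_le_of_abs_le {v w : EuclideanSpace ℝ ι} (h : ∀ i, |v i| ≤ |w i|) : ‖v‖ ≤ ‖w‖ := by
  refine (sq_le_sq₀ (norm_nonneg _) (norm_nonneg _)).1 ?_
  rw [EuclideanSpace.norm_sq_eq, EuclideanSpace.norm_sq_eq]
  refine Finset.sum_le_sum fun i _ => ?_
  simpa [sq_abs] using sq_le_sq' (by linarith [abs_nonneg (v i), abs_nonneg (w i), h i]) (h i)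

lemma norm_le_mul_of_abs_le {v w : EuclideanSpace ℝ ι} {K : ℝ} (hK : 0 ≤ K)
    (h : ∀ i, |v i| ≤ K * |w i|) : ‖v‖ ≤ K * ‖w‖ := by
  have := norm_le_of_abs_le (v := v) (w := K • w) fun i => by
    simpa [abs_mul, abs_of_nonneg hK] using h i
  simpa [norm_smul, abs_of_nonneg hK] using this

lemma norm_le_sqrt_card_mul {v : EuclideanSpace ℝ ι} {K : ℝ} (hK : 0 ≤ K) (h : ∀ i, |v i| ≤ K) :
    ‖v‖ ≤ Real.sqrt (Fintype.card ι) * K := by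
  refine (sq_le_sq₀ (norm_nonneg _) (by positivity)).1 ?_
  rw [EuclideanSpace.norm_sq_eq, mul_pow, Real.sq_sqrt (by positivity)]
  calc ∑ i, ‖v i‖ ^ 2 ≤ ∑ _i : ι, K ^ 2 :=
        Finset.sum_le_sum fun i _ => pow_le_pow_left₀ (norm_nonneg _) (by simpa using h i) 2
    _ = _ := by simp

lemma norm_le_card_mul {v : EuclideanSpace ℝ ι} {K : ℝ} (hK : 0 ≤ K) (h : ∀ i, |v i| ≤ K) :
    ‖v‖ ≤ Fintype.card ι * K := by
  refine (norm_le_sqrt_card_mul hK h).trans (mul_le_mul_of_nonneg_right ?_ hK)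
  rcases Nat.eq_zero_or_pos (Fintype.card ι) with h0 | h0
  · simp [h0]
  · have : (1 : ℝ) ≤ Fintype.card ι := by exact_mod_cast h0
    rw [Real.sqrt_le_left (by positivity)]
    nlinarith

lemma norm_le_sum_abs (v : EuclideanSpace ℝ ι) : ‖v‖ ≤ ∑ i, |v i| := by
  refine (sq_le_sq₀ (norm_nonneg _) (Finset.sum_nonneg fun _ _ => abs_nonneg _)).1 ?_
  rw [EuclideanSpace.norm_sq_eq, sq (∑ i, |v i|), Finset.sum_mul]
  refine Finset.sum_le_sum fun i _ => ?_
  rw [sq]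
  exact mul_le_mul_of_nonneg_left
    (Finset.single_le_sum (f := fun i => |v i|) (fun _ _ => abs_nonneg _) (Finset.mem_univ i))
    (norm_nonneg _)

lemma sum_mul_le_norm_mul_norm (v w : EuclideanSpace ℝ ι) : ∑ i, |v i| * |w i| ≤ ‖v‖ * ‖w‖ := by
  have := Real.sum_mul_le_sqrt_mul_sqrt Finset.univ (fun i => |v i|) (fun i => |w i|)
  simpa [EuclideanSpace.norm_eq] using this

variable [DecidableEq κ]

lemma norm_mv_le (G : Matrix ι κ ℝ) (v : EuclideanSpace ℝ κ) : ‖mv G v‖ ≤ ‖G‖ * ‖v‖ :=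
  Matrix.l2_opNorm_mulVec G v

lemma opNorm_le_of_mv {G : Matrix ι κ ℝ} {K : ℝ} (hK : 0 ≤ K) (h : ∀ v, ‖mv G v‖ ≤ K * ‖v‖) :
    ‖G‖ ≤ K := by
  rw [Matrix.l2_opNorm_def]
  exact ContinuousLinearMap.opNorm_le_bound _ hK h

lemma abs_entry_le_norm (G : Matrix ι κ ℝ) (i : ι) (j : κ) : |G i j| ≤ ‖G‖ := by
  have h := (abs_apply_le_norm _ i).trans (norm_mv_le G (EuclideanSpace.single j 1))
  simpa using h

/-- Cauchy-Schwarz in each row. It turns entrywise rounding errors into spectral norm errors. -/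
lemma norm_le_sqrt_sum_sq (G : Matrix ι κ ℝ) : ‖G‖ ≤ Real.sqrt (∑ i, ∑ j, G i j ^ 2) := by
  refine opNorm_le_of_mv (Real.sqrt_nonneg _) fun v => ?_
  refine (sq_le_sq₀ (norm_nonneg _) (by positivity)).1 ?_
  rw [mul_pow, Real.sq_sqrt (by positivity), EuclideanSpace.norm_sq_eq, EuclideanSpace.norm_sq_eq,
    Finset.sum_mul]
  refine Finset.sum_le_sum fun i _ => ?_
  simpa [Matrix.mulVec, dotProduct] using Finset.sum_mul_sq_le_sq_mul_sq Finset.univ (G i) v.ofLp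

lemma norm_le_of_entry_le [Nonempty ι] {G : Matrix ι ι ℝ} [DecidableEq ι] {K : ℝ} (hK : 0 ≤ K)
    (h : ∀ i j, |G i j| ≤ K) : ‖G‖ ≤ Fintype.card ι * K := by
  refine (norm_le_sqrt_sum_sq G).trans ?_
  rw [Real.sqrt_le_left (by positivity)]
  calc ∑ i, ∑ j, G i j ^ 2 ≤ ∑ _i : ι, ∑ _j : ι, K ^ 2 := by
        refine Finset.sum_le_sum fun i _ => Finset.sum_le_sum fun j _ => ?_
        rw [← sq_abs]
        exact pow_le_pow_left₀ (abs_nonneg _) (h i j) 2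
    _ = _ := by simp; ring

lemma norm_transpose_eq [DecidableEq ι] (G : Matrix ι κ ℝ) : ‖Gᵀ‖ = ‖G‖ := by
  simpa using Matrix.l2_opNorm_conjTranspose G

/-- A matrix that is bounded below is regular, and its inverse is bounded accordingly. -/
lemma isUnit_det_of_bounded_below {G : Matrix κ κ ℝ} {K : ℝ} (hK : 0 ≤ K)
    (h : ∀ v, ‖v‖ ≤ K * ‖mv G v‖) : IsUnit G.det ∧ ‖G⁻¹‖ ≤ K := by
  have hu : IsUnit G.det := by
    rw [← Matrix.isUnit_iff_isUnit_det, ← Matrix.mulVec_injective_iff_isUnit]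
    intro v w hvw
    have h1 := h (WithLp.toLp 2 v - WithLp.toLp 2 w)
    have h2 : mv G (WithLp.toLp 2 v - WithLp.toLp 2 w) = 0 := by
      rw [mv_sub]; simp only [mv]; rw [hvw, sub_self]
    rw [h2, norm_zero, mul_zero] at h1
    have h3 := sub_eq_zero.1 (norm_le_zero_iff.1 h1)
    simpa using congrArg WithLp.ofLp h3
  refine ⟨hu, opNorm_le_of_mv hK fun v => ?_⟩
  have h1 := h (mv G⁻¹ v)
  have h2 : mv G (mv G⁻¹ v) = v := by
    ext i
    simp [mv, Matrix.mulVec_mulVec, Matrix.mul_nonsing_inv _ hu]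
  rwa [h2] at h1

/-- A small perturbation of a matrix that is bounded below is bounded below. -/
lemma bounded_below_perturb {G J : Matrix κ κ ℝ} {K : ℝ} (hK : 0 ≤ K)
    (h : ∀ v, ‖v‖ ≤ K * ‖mv G v‖) (hJ : K * ‖J - G‖ ≤ 1 / 2) (v : EuclideanSpace ℝ κ) :
    ‖v‖ ≤ 2 * K * ‖mv J v‖ := by
  have h1 : mv G v = mv J v - mv (J - G) v := by rw [mv_sub_left]; abel
  have h2 : ‖mv G v‖ ≤ ‖mv J v‖ + ‖J - G‖ * ‖v‖ := by
    rw [h1]; exact (norm_sub_le _ _).trans (by gcongr; exact norm_mv_le _ _)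
  have h3 := (h v).trans (mul_le_mul_of_nonneg_left h2 hK)
  have h4 := mul_le_mul_of_nonneg_right hJ (norm_nonneg v)
  nlinarith

end Generic

variable {n m : ℕ}

/-! ### The four blocks of the primal-dual vector. -/

section Blocks

/-- The block `x` of `z` as a vector of a Euclidean space. -/
abbrev xV (z : PDSpace n m) : EuclideanSpace ℝ (Fin n) := WithLp.toLp 2 (xPart z)
/-- The block `lam` of `z` as a vector of a Euclidean space. -/
abbrev lamV (z : PDSpace n m) : EuclideanSpace ℝ (Fin m) := WithLp.toLp 2 (lamPart z)
/-- The block `muL` of `z` as a vector of a Euclidean space. -/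
abbrev muLV (z : PDSpace n m) : EuclideanSpace ℝ (Fin n) := WithLp.toLp 2 (muLPart z)
/-- The block `muR` of `z` as a vector of a Euclidean space. -/
abbrev muRV (z : PDSpace n m) : EuclideanSpace ℝ (Fin n) := WithLp.toLp 2 (muRPart z)

lemma sum_idx (f : Idx n m → ℝ) : ∑ a, f a =
    ∑ i, f (ixX i) + ∑ k, f (ixLam k) + ∑ i, f (ixL i) + ∑ i, f (ixR i) := by
  simp only [Fintype.sum_sum_type]; ring

lemma norm_sq_blocks (z : PDSpace n m) :
    ‖z‖ ^ 2 = ‖xV z‖ ^ 2 + ‖lamV z‖ ^ 2 + ‖muLV z‖ ^ 2 + ‖muRV z‖ ^ 2 := by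
  simp only [EuclideanSpace.norm_sq_eq, sum_idx]
  rfl

lemma norm_xV_le (z : PDSpace n m) : ‖xV z‖ ≤ ‖z‖ := by
  refine (sq_le_sq₀ (norm_nonneg _) (norm_nonneg _)).1 ?_
  rw [norm_sq_blocks z]
  nlinarith [sq_nonneg ‖lamV z‖, sq_nonneg ‖muLV z‖, sq_nonneg ‖muRV z‖]

lemma norm_lamV_le (z : PDSpace n m) : ‖lamV z‖ ≤ ‖z‖ := by
  refine (sq_le_sq₀ (norm_nonneg _) (norm_nonneg _)).1 ?_
  rw [norm_sq_blocks z]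
  nlinarith [sq_nonneg ‖xV z‖, sq_nonneg ‖muLV z‖, sq_nonneg ‖muRV z‖]

lemma norm_muLV_le (z : PDSpace n m) : ‖muLV z‖ ≤ ‖z‖ := by
  refine (sq_le_sq₀ (norm_nonneg _) (norm_nonneg _)).1 ?_
  rw [norm_sq_blocks z]
  nlinarith [sq_nonneg ‖xV z‖, sq_nonneg ‖lamV z‖, sq_nonneg ‖muRV z‖]

lemma norm_muRV_le (z : PDSpace n m) : ‖muRV z‖ ≤ ‖z‖ := by
  refine (sq_le_sq₀ (norm_nonneg _) (norm_nonneg _)).1 ?_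
  rw [norm_sq_blocks z]
  nlinarith [sq_nonneg ‖xV z‖, sq_nonneg ‖lamV z‖, sq_nonneg ‖muLV z‖]

lemma norm_le_sum_blocks (z : PDSpace n m) :
    ‖z‖ ≤ ‖xV z‖ + ‖lamV z‖ + ‖muLV z‖ + ‖muRV z‖ := by
  refine (sq_le_sq₀ (norm_nonneg _) (by positivity)).1 ?_
  rw [norm_sq_blocks z]
  nlinarith [norm_nonneg (xV z), norm_nonneg (lamV z), norm_nonneg (muLV z), norm_nonneg (muRV z),
    mul_nonneg (norm_nonneg (xV z)) (norm_nonneg (lamV z)),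
    mul_nonneg (norm_nonneg (xV z)) (norm_nonneg (muLV z)),
    mul_nonneg (norm_nonneg (xV z)) (norm_nonneg (muRV z)),
    mul_nonneg (norm_nonneg (lamV z)) (norm_nonneg (muLV z)),
    mul_nonneg (norm_nonneg (lamV z)) (norm_nonneg (muRV z)),
    mul_nonneg (norm_nonneg (muLV z)) (norm_nonneg (muRV z))]

lemma forall_idx {p : Idx n m → Prop} (h1 : ∀ i, p (ixX i)) (h2 : ∀ k, p (ixLam k))
    (h3 : ∀ i, p (ixL i)) (h4 : ∀ i, p (ixR i)) (a : Idx n m) : p a := by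
  rcases a with i | k | i | i
  exacts [h1 i, h2 k, h3 i, h4 i]

end Blocks

/-! ### Block rows of DF and the Taylor expansion of F_τ. -/

section Jacobian

variable (P : ProblemData n m) (ω τ : ℝ) (z v d : PDSpace n m)

lemma mv_jacF_x (i : Fin n) : mv (jacF P ω z) v (ixX i) =
    (P.Q *ᵥ xPart v) i + ω * xPart v i - (P.Aᵀ *ᵥ lamPart v) i - muLPart v i + muRPart v i := by
  have h1 : v.ofLp ∘ Sum.inl = xPart v := rfl
  have h2 : (v.ofLp ∘ Sum.inr) ∘ Sum.inl = lamPart v := rfl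
  have h3 : ((v.ofLp ∘ Sum.inr) ∘ Sum.inr) ∘ Sum.inl = muLPart v := rfl
  have h4 : ((v.ofLp ∘ Sum.inr) ∘ Sum.inr) ∘ Sum.inr = muRPart v := rfl
  simp only [mv_apply, jacF, Matrix.fromBlocks_mulVec, Matrix.fromCols_mulVec, h1, h2, h3, h4,
    Sum.elim_inl, Pi.add_apply, Matrix.add_mulVec, Matrix.smul_mulVec, Matrix.one_mulVec,
    Matrix.neg_mulVec, Pi.neg_apply, Pi.smul_apply, smul_eq_mul]
  ring

lemma mv_jacF_lam (k : Fin m) : mv (jacF P ω z) v (ixLam k) =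
    (P.A *ᵥ xPart v) k + ω * lamPart v k := by
  have h1 : v.ofLp ∘ Sum.inl = xPart v := rfl
  have h2 : (v.ofLp ∘ Sum.inr) ∘ Sum.inl = lamPart v := rfl
  simp only [mv_apply, jacF, Matrix.fromBlocks_mulVec, Matrix.fromRows_mulVec, h1, h2,
    Sum.elim_inl, Sum.elim_inr, Pi.add_apply, Matrix.smul_mulVec, Matrix.one_mulVec,
    Matrix.zero_mulVec, Pi.smul_apply, smul_eq_mul, add_zero]

lemma mv_jacF_L (i : Fin n) : mv (jacF P ω z) v (ixL i) =
    muLPart z i * xPart v i + (1 + xPart z i) * muLPart v i := by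
  have h1 : v.ofLp ∘ Sum.inl = xPart v := rfl
  have h3 : ((v.ofLp ∘ Sum.inr) ∘ Sum.inr) ∘ Sum.inl = muLPart v := rfl
  simp only [mv_apply, jacF, Matrix.fromBlocks_mulVec, Matrix.fromRows_mulVec, h1, h3,
    Sum.elim_inl, Sum.elim_inr, Pi.add_apply, Matrix.mulVec_diagonal,
    Matrix.zero_mulVec, add_zero, zero_add]

lemma mv_jacF_R (i : Fin n) : mv (jacF P ω z) v (ixR i) =
    -(muRPart z i * xPart v i) + (1 - xPart z i) * muRPart v i := by
  have h1 : v.ofLp ∘ Sum.inl = xPart v := rfl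
  have h4 : ((v.ofLp ∘ Sum.inr) ∘ Sum.inr) ∘ Sum.inr = muRPart v := rfl
  simp only [mv_apply, jacF, Matrix.fromBlocks_mulVec, Matrix.fromRows_mulVec, h1, h4,
    Sum.elim_inr, Pi.add_apply, Matrix.mulVec_diagonal, Matrix.neg_mulVec, Pi.neg_apply,
    Matrix.zero_mulVec, zero_add]

lemma optF_x (i : Fin n) : optF P ω τ z (ixX i) = (P.Q *ᵥ xPart z) i + ω * xPart z i + P.c i
    - (P.Aᵀ *ᵥ lamPart z) i - muLPart z i + muRPart z i := rfl

lemma optF_lam (k : Fin m) : optF P ω τ z (ixLam k) =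
    (P.A *ᵥ xPart z) k - P.b k + ω * lamPart z k := rfl

lemma optF_L (i : Fin n) : optF P ω τ z (ixL i) = muLPart z i * (1 + xPart z i) - τ := rfl

lemma optF_R (i : Fin n) : optF P ω τ z (ixR i) = muRPart z i * (1 - xPart z i) - τ := rfl

lemma xPart_add : xPart (z + d) = xPart z + xPart d := rfl
lemma lamPart_add : lamPart (z + d) = lamPart z + lamPart d := rfl
lemma muLPart_add : muLPart (z + d) = muLPart z + muLPart d := rfl
lemma muRPart_add : muRPart (z + d) = muRPart z + muRPart d := rfl

lemma optF_add_x (i : Fin n) : optF P ω τ (z + d) (ixX i) =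
    optF P ω τ z (ixX i) + mv (jacF P ω z) d (ixX i) := by
  simp only [optF_x, mv_jacF_x, xPart_add, lamPart_add, muLPart_add, muRPart_add,
    Matrix.mulVec_add, Pi.add_apply]
  ring

lemma optF_add_lam (k : Fin m) : optF P ω τ (z + d) (ixLam k) =
    optF P ω τ z (ixLam k) + mv (jacF P ω z) d (ixLam k) := by
  simp only [optF_lam, mv_jacF_lam, xPart_add, lamPart_add, Matrix.mulVec_add, Pi.add_apply]
  ring

lemma optF_add_L (i : Fin n) : optF P ω τ (z + d) (ixL i) =
    optF P ω τ z (ixL i) + mv (jacF P ω z) d (ixL i) + muLPart d i * xPart d i := by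
  simp only [optF_L, mv_jacF_L, xPart_add, muLPart_add, Pi.add_apply]
  ring

lemma optF_add_R (i : Fin n) : optF P ω τ (z + d) (ixR i) =
    optF P ω τ z (ixR i) + mv (jacF P ω z) d (ixR i) - muRPart d i * xPart d i := by
  simp only [optF_R, mv_jacF_R, xPart_add, muRPart_add, Pi.add_apply]
  ring

/-- `F_τ` is quadratic, so its increments are given by the Jacobian at the midpoint. -/
lemma optF_sub_eq_midpoint :
    optF P ω τ (z + d) - optF P ω τ z = mv (jacF P ω (z + (1 / 2 : ℝ) • d)) d := by
  have hx : xPart ((1 / 2 : ℝ) • d) = (1 / 2 : ℝ) • xPart d := rfl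
  have hL : muLPart ((1 / 2 : ℝ) • d) = (1 / 2 : ℝ) • muLPart d := rfl
  have hR : muRPart ((1 / 2 : ℝ) • d) = (1 / 2 : ℝ) • muRPart d := rfl
  ext a
  rw [PiLp.sub_apply]
  revert a
  refine forall_idx (fun i => ?_) (fun k => ?_) (fun i => ?_) (fun i => ?_)
  · rw [optF_add_x, mv_jacF_x, mv_jacF_x]; ring
  · rw [optF_add_lam, mv_jacF_lam, mv_jacF_lam]; ring
  · rw [optF_add_L, mv_jacF_L, mv_jacF_L]
    simp only [xPart_add, muLPart_add, hx, hL, Pi.add_apply, Pi.smul_apply, smul_eq_mul]; ring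
  · rw [optF_add_R, mv_jacF_R, mv_jacF_R]
    simp only [xPart_add, muRPart_add, hx, hR, Pi.add_apply, Pi.smul_apply, smul_eq_mul]; ring

end Jacobian

/-! ### Norm, Lipschitz constant and inverse bound of the Jacobian. -/

section Bounds

variable {P : ProblemData n m} {ω : ℝ} {z : PDSpace n m}

/-- The four block rows are estimated separately: the two identity blocks contribute 2, and each
complementarity row contributes 1 + 2B. With B = Cz the total is dominated by the rule for CDF. -/
lemma norm_jacF_le {B : ℝ} (hω : 0 ≤ ω) (hB : 0 ≤ B) (hz : ‖z‖ ≤ B) :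
    ‖jacF P ω z‖ ≤ ‖P.Q‖ + 2 * ω + 2 * ‖P.A‖ + 4 + 4 * B := by
  refine opNorm_le_of_mv (by positivity) fun v => ?_
  have hx := norm_xV_le v
  have hl := norm_lamV_le v
  have hL := norm_muLV_le v
  have hR := norm_muRV_le v
  have key : ∀ (f g : Fin n → ℝ), (∀ i, |f i| ≤ B) → (∀ i, |g i| ≤ 1 + B) →
      ∀ a b : EuclideanSpace ℝ (Fin n), ‖a‖ ≤ ‖v‖ → ‖b‖ ≤ ‖v‖ →
      ‖(WithLp.toLp 2 (fun i => f i * a i + g i * b i) : EuclideanSpace ℝ (Fin n))‖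
        ≤ (1 + 2 * B) * ‖v‖ := by
    intro f g hf hg a b ha hb
    have h1 : ‖(WithLp.toLp 2 (fun i => f i * a i) : EuclideanSpace ℝ (Fin n))‖ ≤ B * ‖a‖ :=
      norm_le_mul_of_abs_le hB fun i => by
        simpa [abs_mul] using mul_le_mul_of_nonneg_right (hf i) (abs_nonneg (a i))
    have h2 : ‖(WithLp.toLp 2 (fun i => g i * b i) : EuclideanSpace ℝ (Fin n))‖
        ≤ (1 + B) * ‖b‖ :=
      norm_le_mul_of_abs_le (by positivity) fun i => by
        simpa [abs_mul] using mul_le_mul_of_nonneg_right (hg i) (abs_nonneg (b i))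
    have h3 : (WithLp.toLp 2 (fun i => f i * a i + g i * b i) : EuclideanSpace ℝ (Fin n)) =
        WithLp.toLp 2 (fun i => f i * a i) + WithLp.toLp 2 (fun i => g i * b i) := rfl
    rw [h3]
    refine (norm_add_le _ _).trans ?_
    nlinarith
  have bx : ∀ i, |xPart z i| ≤ B := fun i => (abs_apply_le_norm z _).trans hz
  have bL : ∀ i, |muLPart z i| ≤ B := fun i => (abs_apply_le_norm z _).trans hz
  have bR : ∀ i, |muRPart z i| ≤ B := fun i => (abs_apply_le_norm z _).trans hz
  have e1 : xV (mv (jacF P ω z) v) =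
      mv P.Q (xV v) + ω • xV v - mv P.Aᵀ (lamV v) - muLV v + muRV v := by
    ext i; exact mv_jacF_x P ω z v i
  have e2 : lamV (mv (jacF P ω z) v) = mv P.A (xV v) + ω • lamV v := by
    ext i; exact mv_jacF_lam P ω z v i
  have e3 : muLV (mv (jacF P ω z) v) =
      WithLp.toLp 2 (fun i => muLPart z i * xV v i + (1 + xPart z i) * muLV v i) := by
    ext i; exact mv_jacF_L P ω z v i
  have e4 : muRV (mv (jacF P ω z) v) =
      WithLp.toLp 2 (fun i => (-muRPart z i) * xV v i + (1 - xPart z i) * muRV v i) := by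
    ext i; refine (mv_jacF_R P ω z v i).trans ?_
    simp
  have n1 : ‖xV (mv (jacF P ω z) v)‖ ≤ (‖P.Q‖ + ω + ‖P.A‖ + 2) * ‖v‖ := by
    rw [e1]
    have t1 := norm_mv_le P.Q (xV v)
    have t2 : ‖ω • xV v‖ = ω * ‖xV v‖ := by rw [norm_smul, Real.norm_of_nonneg hω]
    have t3 := norm_mv_le P.Aᵀ (lamV v)
    rw [norm_transpose_eq] at t3
    have s1 := mul_le_mul_of_nonneg_left hx (norm_nonneg P.Q)
    have s2 := mul_le_mul_of_nonneg_left hx hω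
    have s3 := mul_le_mul_of_nonneg_left hl (norm_nonneg P.A)
    have u1 := norm_add_le (mv P.Q (xV v) + ω • xV v - mv P.Aᵀ (lamV v) - muLV v) (muRV v)
    have u2 := norm_sub_le (mv P.Q (xV v) + ω • xV v - mv P.Aᵀ (lamV v)) (muLV v)
    have u3 := norm_sub_le (mv P.Q (xV v) + ω • xV v) (mv P.Aᵀ (lamV v))
    have u4 := norm_add_le (mv P.Q (xV v)) (ω • xV v)
    linarith
  have n2 : ‖lamV (mv (jacF P ω z) v)‖ ≤ (‖P.A‖ + ω) * ‖v‖ := by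
    rw [e2]
    have t1 := norm_mv_le P.A (xV v)
    have t2 : ‖ω • lamV v‖ = ω * ‖lamV v‖ := by rw [norm_smul, Real.norm_of_nonneg hω]
    have s1 := mul_le_mul_of_nonneg_left hx (norm_nonneg P.A)
    have s2 := mul_le_mul_of_nonneg_left hl hω
    have u4 := norm_add_le (mv P.A (xV v)) (ω • lamV v)
    linarith
  have n3 : ‖muLV (mv (jacF P ω z) v)‖ ≤ (1 + 2 * B) * ‖v‖ := by
    rw [e3]
    exact key _ _ bL (fun i => (abs_add_le _ _).trans (by simpa using bx i)) _ _ hx hL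
  have n4 : ‖muRV (mv (jacF P ω z) v)‖ ≤ (1 + 2 * B) * ‖v‖ := by
    rw [e4]
    exact key _ _ (fun i => by simpa using bR i)
      (fun i => (abs_sub _ _).trans (by simpa using bx i)) _ _ hx hR
  have := norm_le_sum_blocks (mv (jacF P ω z) v)
  linarith

/-- Only the complementarity rows depend on z, and they do so linearly. Cauchy-Schwarz bounds each
of these two blocks by ‖z' - z‖·‖v‖. -/
lemma norm_mv_jacF_sub_le (z' v : PDSpace n m) :
    ‖mv (jacF P ω z' - jacF P ω z) v‖ ≤ 2 * ‖z' - z‖ * ‖v‖ := by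
  set d := z' - z with hd
  have hz' : z' = z + d := by rw [hd]; abel
  set w := mv (jacF P ω z' - jacF P ω z) v with hw
  have wx : xV w = 0 := by
    ext i
    show w (ixX i) = 0
    rw [hw, mv_sub_left, PiLp.sub_apply, mv_jacF_x, mv_jacF_x, sub_self]
  have wl : lamV w = 0 := by
    ext i
    show w (ixLam i) = 0
    rw [hw, mv_sub_left, PiLp.sub_apply, mv_jacF_lam, mv_jacF_lam, sub_self]
  have wL : ∀ i, muLPart w i = muLPart d i * xPart v i + xPart d i * muLPart v i := by
    intro i
    show w (ixL i) = _
    rw [hw, mv_sub_left, PiLp.sub_apply, mv_jacF_L, mv_jacF_L, hz', xPart_add, muLPart_add,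
      Pi.add_apply, Pi.add_apply]
    ring
  have wR : ∀ i, muRPart w i = -(muRPart d i * xPart v i + xPart d i * muRPart v i) := by
    intro i
    show w (ixR i) = _
    rw [hw, mv_sub_left, PiLp.sub_apply, mv_jacF_R, mv_jacF_R, hz', xPart_add, muRPart_add,
      Pi.add_apply, Pi.add_apply]
    ring
  have hsq : ∀ f : Fin n → ℝ,
      ‖(WithLp.toLp 2 f : EuclideanSpace ℝ (Fin n))‖ ^ 2 = ∑ i, f i ^ 2 := by
    intro f; simp [EuclideanSpace.norm_sq_eq]
  have key : ∀ a b e f : EuclideanSpace ℝ (Fin n), ∑ i, (a i * b i + e i * f i) ^ 2 ≤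
      (‖a‖ ^ 2 + ‖e‖ ^ 2) * (‖b‖ ^ 2 + ‖f‖ ^ 2) := by
    intro a b e f
    have h0 : ∀ g : EuclideanSpace ℝ (Fin n), ‖g‖ ^ 2 = ∑ i, g i ^ 2 := fun g => hsq g.ofLp
    rw [h0 a, h0 b, h0 e, h0 f, ← Finset.sum_add_distrib, ← Finset.sum_add_distrib,
      Finset.sum_mul]
    refine Finset.sum_le_sum fun i _ => ?_
    have h1 : b i ^ 2 + f i ^ 2 ≤ ∑ i, (b i ^ 2 + f i ^ 2) :=
      Finset.single_le_sum (f := fun i => b i ^ 2 + f i ^ 2) (fun _ _ => by positivity)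
        (Finset.mem_univ i)
    refine le_trans ?_ (mul_le_mul_of_nonneg_left h1 (by positivity))
    nlinarith [sq_nonneg (a i * f i - e i * b i)]
  have nd := norm_sq_blocks d
  have nv := norm_sq_blocks v
  have nw := norm_sq_blocks w
  rw [wx, wl] at nw
  have kL := key (muLV d) (xV v) (xV d) (muLV v)
  have kR := key (muRV d) (xV v) (xV d) (muRV v)
  have nL : ‖muLV w‖ ^ 2 = ∑ i, (muLPart d i * xPart v i + xPart d i * muLPart v i) ^ 2 := by
    rw [hsq]; simp only [wL]
  have nR : ‖muRV w‖ ^ 2 = ∑ i, (muRPart d i * xPart v i + xPart d i * muRPart v i) ^ 2 := by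
    rw [hsq]; simp only [wR, neg_sq]
  have hL : ‖muLV w‖ ^ 2 ≤ ‖d‖ ^ 2 * ‖v‖ ^ 2 := by
    rw [nL]
    refine kL.trans (mul_le_mul ?_ ?_ (by positivity) (by positivity)) <;>
      linarith [sq_nonneg ‖lamV d‖, sq_nonneg ‖muRV d‖, sq_nonneg ‖lamV v‖, sq_nonneg ‖muRV v‖]
  have hR : ‖muRV w‖ ^ 2 ≤ ‖d‖ ^ 2 * ‖v‖ ^ 2 := by
    rw [nR]
    refine kR.trans (mul_le_mul ?_ ?_ (by positivity) (by positivity)) <;>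
      linarith [sq_nonneg ‖lamV d‖, sq_nonneg ‖muLV d‖, sq_nonneg ‖lamV v‖, sq_nonneg ‖muLV v‖]
  refine (sq_le_sq₀ (norm_nonneg _) (by positivity)).1 ?_
  rw [nw]
  rw [norm_zero, norm_zero, mul_pow, mul_pow]
  have : 0 ≤ ‖d‖ ^ 2 * ‖v‖ ^ 2 := by positivity
  linarith

/-- The quadratic form of the first two block rows of `DF`, in which `A` cancels. -/
lemma saddle_form_eq (v : PDSpace n m) :
    ∑ i, xPart v i * mv (jacF P ω z) v (ixX i) + ∑ k, lamPart v k * mv (jacF P ω z) v (ixLam k) =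
    xPart v ⬝ᵥ P.Q *ᵥ xPart v + ω * ∑ i, xPart v i ^ 2 + ω * ∑ k, lamPart v k ^ 2 -
      ∑ i, xPart v i * muLPart v i + ∑ i, xPart v i * muRPart v i := by
  have hA : xPart v ⬝ᵥ P.Aᵀ *ᵥ lamPart v = lamPart v ⬝ᵥ P.A *ᵥ xPart v := by
    rw [Matrix.dotProduct_mulVec, Matrix.vecMul_transpose, dotProduct_comm]
  have e1 : ∑ i, xPart v i * mv (jacF P ω z) v (ixX i) = xPart v ⬝ᵥ P.Q *ᵥ xPart v +
      ω * ∑ i, xPart v i ^ 2 - xPart v ⬝ᵥ P.Aᵀ *ᵥ lamPart v - ∑ i, xPart v i * muLPart v i +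
      ∑ i, xPart v i * muRPart v i := by
    simp only [dotProduct, Finset.mul_sum, ← Finset.sum_add_distrib, ← Finset.sum_sub_distrib]
    refine Finset.sum_congr rfl fun i _ => ?_
    rw [mv_jacF_x]; ring
  have e2 : ∑ k, lamPart v k * mv (jacF P ω z) v (ixLam k) =
      lamPart v ⬝ᵥ P.A *ᵥ xPart v + ω * ∑ k, lamPart v k ^ 2 := by
    simp only [dotProduct, Finset.mul_sum, ← Finset.sum_add_distrib]
    refine Finset.sum_congr rfl fun i _ => ?_
    rw [mv_jacF_lam]; ring
  rw [e1, e2, hA]; ring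

/-- The quadratic form of `DF` with its last two block rows scaled by the inverses of the
multipliers. -/
lemma weighted_form_eq (v : PDSpace n m) (hL : ∀ i, 0 < muLPart z i) (hR : ∀ i, 0 < muRPart z i) :
    ∑ i, xPart v i * mv (jacF P ω z) v (ixX i) + ∑ k, lamPart v k * mv (jacF P ω z) v (ixLam k) +
      ∑ i, muLPart v i / muLPart z i * mv (jacF P ω z) v (ixL i) +
      ∑ i, muRPart v i / muRPart z i * mv (jacF P ω z) v (ixR i) =
    xPart v ⬝ᵥ P.Q *ᵥ xPart v + ω * ∑ i, xPart v i ^ 2 + ω * ∑ k, lamPart v k ^ 2 +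
      ∑ i, (1 + xPart z i) / muLPart z i * muLPart v i ^ 2 +
      ∑ i, (1 - xPart z i) / muRPart z i * muRPart v i ^ 2 := by
  have e3 : ∑ i, muLPart v i / muLPart z i * mv (jacF P ω z) v (ixL i) =
      ∑ i, xPart v i * muLPart v i + ∑ i, (1 + xPart z i) / muLPart z i * muLPart v i ^ 2 := by
    simp only [← Finset.sum_add_distrib]
    refine Finset.sum_congr rfl fun i _ => ?_
    have := (hL i).ne'
    rw [mv_jacF_L]; field_simp
  have e4 : ∑ i, muRPart v i / muRPart z i * mv (jacF P ω z) v (ixR i) =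
      -∑ i, xPart v i * muRPart v i + ∑ i, (1 - xPart z i) / muRPart z i * muRPart v i ^ 2 := by
    simp only [← Finset.sum_add_distrib, ← Finset.sum_neg_distrib]
    refine Finset.sum_congr rfl fun i _ => ?_
    have := (hR i).ne'
    rw [mv_jacF_R]; field_simp
  rw [saddle_form_eq, e3, e4]; ring

/-- The weighted quadratic form is squeezed from both sides. Its diagonal is at least min(ω, g/B),
which yields the factor `max (1 / ω) (B / g)`; its weights are at most 1/g, so Cauchy-Schwarz bounds
it above by ‖v‖·‖DF v‖/g. The hypothesis g ≤ 1 serves the first two block rows, whose weight is 1.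
-/
lemma jacF_bounded_below {g B : ℝ} (hQ : P.Q.PosSemidef) (hω : 0 < ω) (hg : 0 < g) (hg1 : g ≤ 1)
    (hB : 0 < B) (hx1 : ∀ i, g ≤ 1 + xPart z i) (hx2 : ∀ i, g ≤ 1 - xPart z i)
    (hL : ∀ i, g ≤ muLPart z i) (hR : ∀ i, g ≤ muRPart z i)
    (hLB : ∀ i, muLPart z i ≤ B) (hRB : ∀ i, muRPart z i ≤ B) (v : PDSpace n m) :
    ‖v‖ ≤ 1 / g * max (1 / ω) (B / g) * ‖mv (jacF P ω z) v‖ := by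
  set w := mv (jacF P ω z) v with hw
  set M := max (1 / ω) (B / g) with hM
  have hMpos : 0 < M := lt_max_of_lt_left (by positivity)
  have hL0 : ∀ i, 0 < muLPart z i := fun i => hg.trans_le (hL i)
  have hR0 : ∀ i, 0 < muRPart z i := fun i => hg.trans_le (hR i)
  have form := weighted_form_eq (P := P) (ω := ω) v hL0 hR0
  have hq : 0 ≤ xPart v ⬝ᵥ P.Q *ᵥ xPart v := by
    simpa using hQ.dotProduct_mulVec_nonneg (xPart v)
  have hMω : 1 / M ≤ ω := by
    rw [one_div_le hMpos hω]; exact le_max_left _ _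
  have hMg : 1 / M ≤ g / B := by
    rw [one_div_le hMpos (by positivity), one_div_div]; exact le_max_right _ _
  have hsq : ∀ {k : ℕ} (f : Fin k → ℝ),
      ‖(WithLp.toLp 2 f : EuclideanSpace ℝ (Fin k))‖ ^ 2 = ∑ i, f i ^ 2 := by
    intro k f; simp [EuclideanSpace.norm_sq_eq]
  have tL : 1 / M * ∑ i, muLPart v i ^ 2 ≤
      ∑ i, (1 + xPart z i) / muLPart z i * muLPart v i ^ 2 := by
    rw [Finset.mul_sum]
    refine Finset.sum_le_sum fun i _ => mul_le_mul_of_nonneg_right ?_ (sq_nonneg _)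
    exact hMg.trans (div_le_div₀ (hg.le.trans (hx1 i)) (hx1 i) (hL0 i) (hLB i))
  have tR : 1 / M * ∑ i, muRPart v i ^ 2 ≤
      ∑ i, (1 - xPart z i) / muRPart z i * muRPart v i ^ 2 := by
    rw [Finset.mul_sum]
    refine Finset.sum_le_sum fun i _ => mul_le_mul_of_nonneg_right ?_ (sq_nonneg _)
    exact hMg.trans (div_le_div₀ (hg.le.trans (hx2 i)) (hx2 i) (hR0 i) (hRB i))
  have tx : 1 / M * ∑ i, xPart v i ^ 2 ≤ ω * ∑ i, xPart v i ^ 2 :=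
    mul_le_mul_of_nonneg_right hMω (Finset.sum_nonneg fun _ _ => sq_nonneg _)
  have tl : 1 / M * ∑ i, lamPart v i ^ 2 ≤ ω * ∑ i, lamPart v i ^ 2 :=
    mul_le_mul_of_nonneg_right hMω (Finset.sum_nonneg fun _ _ => sq_nonneg _)
  have lower : 1 / M * ‖v‖ ^ 2 ≤ ∑ i, xPart v i * w (ixX i) + ∑ k, lamPart v k * w (ixLam k) +
      ∑ i, muLPart v i / muLPart z i * w (ixL i) +
      ∑ i, muRPart v i / muRPart z i * w (ixR i) := by
    rw [form, norm_sq_blocks, hsq, hsq, hsq, hsq]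
    linarith
  have hg1' : 1 ≤ 1 / g := by rw [le_div_iff₀ hg]; linarith
  have upper : ∑ i, xPart v i * w (ixX i) + ∑ k, lamPart v k * w (ixLam k) +
      ∑ i, muLPart v i / muLPart z i * w (ixL i) +
      ∑ i, muRPart v i / muRPart z i * w (ixR i) ≤ 1 / g * (‖v‖ * ‖w‖) := by
    refine le_trans ?_ (mul_le_mul_of_nonneg_left (sum_mul_le_norm_mul_norm v w) (by positivity))
    rw [sum_idx, mul_add, mul_add, mul_add]
    simp only [Finset.mul_sum]
    have base : ∀ a b : ℝ, a * b ≤ 1 / g * (|a| * |b|) := fun a b => by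
      have h1 : a * b ≤ |a| * |b| := by rw [← abs_mul]; exact le_abs_self _
      have h2 : 0 ≤ |a| * |b| := by positivity
      nlinarith
    have scaled : ∀ a b c : ℝ, g ≤ c → a / c * b ≤ 1 / g * (|a| * |b|) := fun a b c hc => by
      have hc0 : 0 < c := hg.trans_le hc
      have h1 : a * b ≤ |a| * |b| := by rw [← abs_mul]; exact le_abs_self _
      have h2 : 0 ≤ |a| * |b| := by positivity
      calc a / c * b = 1 / c * (a * b) := by ring
        _ ≤ 1 / c * (|a| * |b|) := mul_le_mul_of_nonneg_left h1 (by positivity)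
        _ ≤ _ := mul_le_mul_of_nonneg_right (one_div_le_one_div_of_le hg hc) h2
    refine add_le_add (add_le_add (add_le_add ?_ ?_) ?_) ?_ <;>
      refine Finset.sum_le_sum fun i _ => ?_
    · exact base _ _
    · exact base _ _
    · exact scaled _ _ _ (hL i)
    · exact scaled _ _ _ (hR i)
  have hfin := lower.trans upper
  rcases eq_or_lt_of_le (norm_nonneg v) with h0 | h0
  · rw [← h0]; positivity
  · have h2 : ‖v‖ * (1 / M * ‖v‖) ≤ ‖v‖ * (1 / g * ‖w‖) := by nlinarith
    have h3 := le_of_mul_le_mul_left h2 h0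
    rw [one_div_mul_eq_div, div_le_iff₀ hMpos] at h3
    linarith

end Bounds

/-! ### Consequences of the parameter rules. -/

section Parameters

variable {P : ProblemData n m} {tol : ℝ} {p : MethodParams}

lemma norm_le_frobNorm (A : Matrix (Fin m) (Fin n) ℝ) : ‖A‖ ≤ frobNorm A :=
  norm_le_sqrt_sum_sq A

namespace MethodParams.Admissible

lemma Clam_nonneg (h : p.Admissible P tol) : 0 ≤ p.Clam := by
  have := h.ω_pos
  exact le_trans (by positivity) h.Clam_ge

lemma CΔμ_nonneg (h : p.Admissible P tol) : 0 ≤ p.CΔμ := by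
  have := h.ω_pos
  have := h.Clam_nonneg
  exact le_trans (by positivity) h.CΔμ_ge

lemma τA_nonneg (h : p.Admissible P tol) : 0 ≤ p.τA :=
  le_trans (le_max_of_le_left (by positivity)) h.τA_ge

lemma μbound_nonneg (h : p.Admissible P tol) : 0 ≤ p.CΔμ + (1 + p.θ) * p.τA := by
  have := h.CΔμ_nonneg
  have := h.τA_nonneg
  have := h.θ_pos
  positivity

lemma μbound_le_Cμ (h : p.Admissible P tol) (hn : 1 ≤ n) :
    p.CΔμ + (1 + p.θ) * p.τA ≤ p.Cμ := by
  refine le_trans ?_ h.Cμ_ge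
  have h1 : 1 ≤ Real.sqrt (2 * n) := by
    rw [Real.one_le_sqrt]
    have : (1 : ℝ) ≤ n := by exact_mod_cast hn
    linarith
  exact le_mul_of_one_le_left h.μbound_nonneg h1

lemma Cμ_le_Cz (h : p.Admissible P tol) : p.Cμ ≤ p.Cz := by
  have h1 : p.Cμ ≤ Real.sqrt (n + p.Clam ^ 2 + p.Cμ ^ 2) := by
    apply Real.le_sqrt_of_sq_le
    have : (0 : ℝ) ≤ n := by positivity
    nlinarith [sq_nonneg p.Clam]
  linarith [h.Cz_ge]

lemma Clam_le_Cz (h : p.Admissible P tol) : p.Clam ≤ p.Cz := by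
  have h1 : p.Clam ≤ Real.sqrt (n + p.Clam ^ 2 + p.Cμ ^ 2) := by
    apply Real.le_sqrt_of_sq_le
    have : (0 : ℝ) ≤ n := by positivity
    nlinarith [sq_nonneg p.Cμ]
  linarith [h.Cz_ge]

lemma one_le_Cz (h : p.Admissible P tol) (hn : 1 ≤ n) : 1 ≤ p.Cz := by
  have h1 : 1 ≤ Real.sqrt (n + p.Clam ^ 2 + p.Cμ ^ 2) := by
    rw [Real.one_le_sqrt]
    have : (1 : ℝ) ≤ n := by exact_mod_cast hn
    nlinarith [sq_nonneg p.Cμ, sq_nonneg p.Clam]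
  linarith [h.Cz_ge]

lemma ω_le_one (h : p.Admissible P tol) : p.ω ≤ 1 := h.ω_le.trans (min_le_right _ _)

/-- The positive number `cGap` is bounded above by a positive multiple of σ. -/
lemma σ_pos (h : p.Admissible P tol) (hn : 1 ≤ n) : 0 < p.σ := by
  have h1 := h.cGap_pos.trans_le h.cGap_le
  have h2 := h.one_le_Cz hn
  have h3 := h.θ_le
  have h4 := h.τE_pos
  have h5 : 0 < (1 - p.θ) / (1 + p.Cz) := div_pos (by linarith) (by linarith)
  by_contra hσ
  have : (1 - p.θ) / (1 + p.Cz) * p.σ * p.τE * (1 / 2) ≤ 0 := by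
    have : (1 - p.θ) / (1 + p.Cz) * p.σ ≤ 0 := mul_nonpos_of_nonneg_of_nonpos h5.le (not_lt.1 hσ)
    nlinarith
  linarith

/-- ‖c‖ is one of the nonnegative summands in the rule for CΔμ. With the bounds on b and τ below,
this lets Cz measure all inputs of the residual evaluation other than Q and A. -/
lemma norm_c_le (h : p.Admissible P tol) (hn : 1 ≤ n) : ‖P.c‖ ≤ p.Cz := by
  refine le_trans ?_ ((h.μbound_le_Cμ hn).trans h.Cμ_le_Cz)
  have := h.ω_pos
  have h1 := h.Clam_nonneg
  have h2 := h.CΔμ_ge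
  have h3 : 0 ≤ (p.ω + ‖P.Q‖) * Real.sqrt n := by positivity
  have h4 : 0 ≤ ‖P.Aᵀ‖ * p.Clam := by positivity
  have h5 : 0 ≤ (1 + p.θ) * p.τA := by have := h.θ_pos; have := h.τA_nonneg; positivity
  linarith

lemma norm_b_le (h : p.Admissible P tol) : ‖P.b‖ ≤ p.Cz := by
  refine le_trans ?_ h.Clam_le_Cz
  have h1 := h.Clam_ge
  rw [div_le_iff₀ h.ω_pos] at h1
  have h2 : 0 ≤ ‖P.A‖ * Real.sqrt n := by positivity
  nlinarith [h.Clam_nonneg, h.ω_le_one]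

lemma τ_le_Cz (h : p.Admissible P tol) (hn : 1 ≤ n) {τ : ℝ} (hτ : τ ≤ p.σ * p.τA) :
    τ ≤ p.Cz := by
  refine le_trans ?_ ((h.μbound_le_Cμ hn).trans h.Cμ_le_Cz)
  have h1 := h.CΔμ_nonneg
  have h2 := h.τA_nonneg
  have h3 := h.θ_pos
  have h4 := h.σ_lt
  nlinarith [mul_nonneg h3.le h2]

lemma CDF_ge' (h : p.Admissible P tol) :
    ‖P.Q‖ + 2 * p.ω + 2 * ‖P.A‖ + 4 + 4 * p.Cz ≤ p.CDF := by
  have := h.CDF_ge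
  have := norm_le_frobNorm P.A
  linarith

lemma CDFinv_pos (h : p.Admissible P tol) : 0 < p.CDFinv := by
  have h1 := h.ω_pos
  have h2 := h.cGap_pos
  have h3 : 0 < max (1 / p.ω) (p.Cz / p.cGap) := lt_max_of_lt_left (by positivity)
  exact lt_of_lt_of_le (by positivity) h.CDFinv_ge

end MethodParams.Admissible

/-! ### Size of the central path neighbourhood and its distance to the boundary. -/

section Neighbourhood

variable {w τ : ℝ} {z : PDSpace n m}

lemma abs_optF_L_le (hz : z ∈ pathNbhd P p.ω w τ) (i : Fin n) :
    |muLPart z i * (1 + xPart z i) - τ| ≤ w * τ :=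
  (abs_apply_le_norm (WithLp.toLp 2 (Sum.elim (fun i => optF P p.ω τ z (ixL i))
    (fun i => optF P p.ω τ z (ixR i))) : EuclideanSpace ℝ (Fin n ⊕ Fin n)) (Sum.inl i)).trans
    hz.2.2.1

lemma abs_optF_R_le (hz : z ∈ pathNbhd P p.ω w τ) (i : Fin n) :
    |muRPart z i * (1 - xPart z i) - τ| ≤ w * τ :=
  (abs_apply_le_norm (WithLp.toLp 2 (Sum.elim (fun i => optF P p.ω τ z (ixL i))
    (fun i => optF P p.ω τ z (ixR i))) : EuclideanSpace ℝ (Fin n ⊕ Fin n)) (Sum.inr i)).trans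
    hz.2.2.1

namespace MethodParams.Admissible

lemma norm_xV_le_of_mem (hz : z ∈ pathNbhd P p.ω w τ) : ‖xV z‖ ≤ Real.sqrt n := by
  simpa using norm_le_sqrt_card_mul (v := xV z) zero_le_one fun i => (hz.2.2.2.1 i).le

lemma norm_lamV_le_of_mem (h : p.Admissible P tol) (hz : z ∈ pathNbhd P p.ω w τ) :
    ‖lamV z‖ ≤ p.Clam := by
  refine le_trans ?_ h.Clam_ge
  rw [le_div_iff₀ h.ω_pos]
  have e : p.ω • lamV z = P.b - mv P.A (xV z) := by
    ext k
    have := hz.2.1 k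
    rw [optF_lam] at this
    simp only [PiLp.smul_apply, PiLp.sub_apply, smul_eq_mul, mv_apply]
    linarith
  have h1 : ‖p.ω • lamV z‖ = p.ω * ‖lamV z‖ := by rw [norm_smul, Real.norm_of_nonneg h.ω_pos.le]
  have h2 := norm_sub_le P.b (mv P.A (xV z))
  have h3 := norm_mv_le P.A (xV z)
  have h4 := mul_le_mul_of_nonneg_left (norm_xV_le_of_mem hz) (norm_nonneg P.A)
  rw [← e, h1] at h2
  linarith

/-- The vanishing first block expresses μL - μR through x and λ, which are already bounded. -/
lemma abs_muL_sub_muR_le (h : p.Admissible P tol) (hz : z ∈ pathNbhd P p.ω w τ) (i : Fin n) :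
    |muLPart z i - muRPart z i| ≤ p.CΔμ := by
  have e : muLV z - muRV z = mv P.Q (xV z) + p.ω • xV z + P.c - mv P.Aᵀ (lamV z) := by
    ext i
    have := hz.1 i
    rw [optF_x] at this
    simp only [PiLp.smul_apply, PiLp.sub_apply, PiLp.add_apply, smul_eq_mul, mv_apply]
    linarith
  refine (abs_apply_le_norm (muLV z - muRV z) i).trans ?_
  refine le_trans ?_ h.CΔμ_ge
  rw [e]
  have hx := norm_xV_le_of_mem hz
  have t1 := norm_mv_le P.Q (xV z)
  have t2 : ‖p.ω • xV z‖ = p.ω * ‖xV z‖ := by rw [norm_smul, Real.norm_of_nonneg h.ω_pos.le]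
  have t3 := norm_mv_le P.Aᵀ (lamV z)
  have s1 := mul_le_mul_of_nonneg_left hx (norm_nonneg P.Q)
  have s2 := mul_le_mul_of_nonneg_left hx h.ω_pos.le
  have s3 := mul_le_mul_of_nonneg_left (h.norm_lamV_le_of_mem hz) (norm_nonneg P.Aᵀ)
  have u1 := norm_sub_le (mv P.Q (xV z) + p.ω • xV z + P.c) (mv P.Aᵀ (lamV z))
  have u2 := norm_add_le (mv P.Q (xV z) + p.ω • xV z) P.c
  have u3 := norm_add_le (mv P.Q (xV z)) (p.ω • xV z)
  linarith

/-- One of the slacks 1 + x and 1 - x is at least 1, so the corresponding multiplier is at most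
(1+θ)τ; the other one differs from it by at most CΔμ. -/
lemma mu_le_of_mem (h : p.Admissible P tol) (hz : z ∈ pathNbhd P p.ω w τ) (hw : w ≤ p.θ)
    (hτ0 : 0 ≤ τ) (hτ : τ ≤ p.σ * p.τA) (i : Fin n) :
    muLPart z i ≤ p.CΔμ + (1 + p.θ) * p.τA ∧ muRPart z i ≤ p.CΔμ + (1 + p.θ) * p.τA := by
  have hL := (abs_le.1 (abs_optF_L_le hz i)).2
  have hR := (abs_le.1 (abs_optF_R_le hz i)).2
  have hd := abs_le.1 (h.abs_muL_sub_muR_le hz i)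
  have hwτ : w * τ ≤ p.θ * τ := mul_le_mul_of_nonneg_right hw hτ0
  have hτA : τ ≤ p.τA := hτ.trans (mul_le_of_le_one_left h.τA_nonneg h.σ_lt.le)
  have hθτ : (1 + p.θ) * τ ≤ (1 + p.θ) * p.τA :=
    mul_le_mul_of_nonneg_left hτA (by linarith [h.θ_pos])
  have hLpos := hz.2.2.2.2.1 i
  have hRpos := hz.2.2.2.2.2 i
  have hC := h.CΔμ_nonneg
  rcases le_total 0 (xPart z i) with hx | hx
  · have : muLPart z i ≤ muLPart z i * (1 + xPart z i) := by nlinarith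
    constructor <;> linarith
  · have : muRPart z i ≤ muRPart z i * (1 - xPart z i) := by nlinarith
    constructor <;> linarith

/-- The margin 1/10 leaves room for the envelopes, whose radii are at most ν₂ ≤ 1/10. The width w is
free so that both 𝒩 and 𝒩_h are covered. -/
lemma norm_le_of_mem (h : p.Admissible P tol) (hz : z ∈ pathNbhd P p.ω w τ) (hw : w ≤ p.θ)
    (hτ0 : 0 ≤ τ) (hτ : τ ≤ p.σ * p.τA) : ‖z‖ ≤ p.Cz - 1 / 10 := by
  have hμ := h.mu_le_of_mem hz hw hτ0 hτ
  have hK := h.μbound_nonneg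
  have hL : ‖muLV z‖ ≤ Real.sqrt n * (p.CΔμ + (1 + p.θ) * p.τA) := by
    simpa using norm_le_sqrt_card_mul (v := muLV z) hK fun i => by
      rw [abs_of_pos (hz.2.2.2.2.1 i)]; exact (hμ i).1
  have hR : ‖muRV z‖ ≤ Real.sqrt n * (p.CΔμ + (1 + p.θ) * p.τA) := by
    simpa using norm_le_sqrt_card_mul (v := muRV z) hK fun i => by
      rw [abs_of_pos (hz.2.2.2.2.2 i)]; exact (hμ i).2
  have hL2 := pow_le_pow_left₀ (norm_nonneg _) hL 2
  have hR2 := pow_le_pow_left₀ (norm_nonneg _) hR 2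
  have hx2 := pow_le_pow_left₀ (norm_nonneg _) (norm_xV_le_of_mem hz) 2
  have hl2 := pow_le_pow_left₀ (norm_nonneg _) (h.norm_lamV_le_of_mem hz) 2
  have hC2 := pow_le_pow_left₀ (by positivity) h.Cμ_ge 2
  rw [mul_pow, Real.sq_sqrt (by positivity)] at hL2 hR2 hC2
  rw [Real.sq_sqrt (by positivity)] at hx2
  have : ‖z‖ ≤ Real.sqrt (n + p.Clam ^ 2 + p.Cμ ^ 2) := by
    apply Real.le_sqrt_of_sq_le
    rw [norm_sq_blocks]
    linarith
  linarith [h.Cz_ge]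

/-- The distance of a point of the neighbourhood to the boundary is at least `2 * cGap`. -/
lemma gap_of_mem (h : p.Admissible P tol) (hn : 1 ≤ n) (hz : z ∈ pathNbhd P p.ω w τ)
    (hw : w ≤ p.θ) (hτE : p.σ * p.τE ≤ τ) (hτ : τ ≤ p.σ * p.τA) (i : Fin n) :
    2 * p.cGap ≤ 1 + xPart z i ∧ 2 * p.cGap ≤ 1 - xPart z i ∧
      2 * p.cGap ≤ muLPart z i ∧ 2 * p.cGap ≤ muRPart z i := by
  have hσ := h.σ_pos hn
  have hτ0 : 0 < τ := (mul_pos hσ h.τE_pos).trans_le hτE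
  have hCz := h.one_le_Cz hn
  have hx := abs_lt.1 (hz.2.2.2.1 i)
  have hLpos := hz.2.2.2.2.1 i
  have hRpos := hz.2.2.2.2.2 i
  have hg : 2 * p.cGap * (1 + p.Cz) ≤ (1 - p.θ) * τ := by
    have h1 := h.cGap_le
    have h2 : (1 - p.θ) / (1 + p.Cz) * p.σ * p.τE * (1 / 2) =
        (1 - p.θ) * (p.σ * p.τE) / (2 * (1 + p.Cz)) := by field_simp
    rw [h2, le_div_iff₀ (by linarith)] at h1
    have h3 : (1 - p.θ) * (p.σ * p.τE) ≤ (1 - p.θ) * τ :=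
      mul_le_mul_of_nonneg_left hτE (by linarith [h.θ_le])
    linarith
  have hwτ : w * τ ≤ p.θ * τ := mul_le_mul_of_nonneg_right hw hτ0.le
  have hL : (1 - p.θ) * τ ≤ muLPart z i * (1 + xPart z i) := by
    have := (abs_le.1 (abs_optF_L_le hz i)).1
    linarith
  have hR : (1 - p.θ) * τ ≤ muRPart z i * (1 - xPart z i) := by
    have := (abs_le.1 (abs_optF_R_le hz i)).1
    linarith
  have hn' := h.norm_le_of_mem hz hw hτ0.le hτ
  have hLC : muLPart z i ≤ 1 + p.Cz := by
    have := (le_abs_self _).trans (abs_apply_le_norm z (ixL i))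
    simp only [muLPart]; linarith
  have hRC : muRPart z i ≤ 1 + p.Cz := by
    have := (le_abs_self _).trans (abs_apply_le_norm z (ixR i))
    simp only [muRPart]; linarith
  have hpos : 0 < 1 + p.Cz := by linarith
  -- A product of slack and multiplier is at least (1-θ)τ and both factors are at most 1 + Cz (a
  -- slack is below 2), so neither factor can be small.
  refine ⟨?_, ?_, ?_, ?_⟩ <;> refine le_of_mul_le_mul_right ?_ hpos
  · refine (hg.trans hL).trans ?_
    rw [mul_comm]
    exact mul_le_mul_of_nonneg_left hLC (by linarith)
  · refine (hg.trans hR).trans ?_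
    rw [mul_comm]
    exact mul_le_mul_of_nonneg_left hRC (by linarith)
  · exact (hg.trans hL).trans (mul_le_mul_of_nonneg_left (by linarith) hLpos.le)
  · exact (hg.trans hR).trans (mul_le_mul_of_nonneg_left (by linarith) hRpos.le)

/-- Points near the neighbourhood have a Jacobian that is bounded below. -/
lemma jacF_bounded_below_of_near (h : p.Admissible P tol) (hn : 1 ≤ n) (hQ : P.Q.PosSemidef)
    (hz : z ∈ pathNbhd P p.ω w τ) (hw : w ≤ p.θ) (hτE : p.σ * p.τE ≤ τ)
    (hτ : τ ≤ p.σ * p.τA) {z' : PDSpace n m} (hz' : ‖z' - z‖ ≤ p.cGap) (hB : ‖z'‖ ≤ p.Cz)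
    (v : PDSpace n m) : ‖v‖ ≤ p.CDFinv * ‖mv (jacF P p.ω z') v‖ := by
  have gap := h.gap_of_mem hn hz hw hτE hτ
  have hd : ∀ a, |z' a - z a| ≤ p.cGap := fun a => (abs_apply_le_norm (z' - z) a).trans hz'
  have hC : ∀ a, z' a ≤ p.Cz := fun a => (le_abs_self _).trans ((abs_apply_le_norm z' a).trans hB)
  -- The slacks 1 + x and 1 - x of one coordinate add up to 2; n ≥ 1 supplies the coordinate.
  have hg1 : p.cGap ≤ 1 := by
    obtain ⟨h1, h2, -⟩ := gap ⟨0, hn⟩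
    linarith [h.cGap_pos]
  refine (jacF_bounded_below hQ h.ω_pos h.cGap_pos hg1 (by linarith [h.one_le_Cz hn])
    (fun i => ?_) (fun i => ?_) (fun i => ?_) (fun i => ?_) (fun i => hC _) (fun i => hC _)
    v).trans (mul_le_mul_of_nonneg_right h.CDFinv_ge (norm_nonneg _))
  · have h1 := (gap i).1
    have h2 := abs_le.1 (hd (ixX i))
    simp only [xPart] at h1 ⊢
    linarith
  · have h1 := (gap i).2.1
    have h2 := abs_le.1 (hd (ixX i))
    simp only [xPart] at h1 ⊢
    linarith
  · have h1 := (gap i).2.2.1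
    have h2 := abs_le.1 (hd (ixL i))
    simp only [muLPart] at h1 ⊢
    linarith
  · have h1 := (gap i).2.2.2
    have h2 := abs_le.1 (hd (ixR i))
    simp only [muRPart] at h1 ⊢
    linarith

lemma norm_jacF_le_CDF (h : p.Admissible P tol) (hn : 1 ≤ n) (hz : ‖z‖ ≤ p.Cz) :
    ‖jacF P p.ω z‖ ≤ p.CDF :=
  (norm_jacF_le h.ω_pos.le (by linarith [h.one_le_Cz hn]) hz).trans h.CDF_ge'

/-- The increment equals the Jacobian at the midpoint applied to z' - z, and the midpoint stays in
the ball of radius Cz by convexity. -/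
lemma norm_optF_sub_le (h : p.Admissible P tol) (hn : 1 ≤ n) {z' : PDSpace n m}
    (hz : ‖z‖ ≤ p.Cz) (hz' : ‖z'‖ ≤ p.Cz) :
    ‖optF P p.ω τ z' - optF P p.ω τ z‖ ≤ p.CDF * ‖z' - z‖ := by
  have e := optF_sub_eq_midpoint P p.ω τ z (z' - z)
  rw [add_sub_cancel] at e
  rw [e]
  refine (norm_mv_le _ _).trans
    (mul_le_mul_of_nonneg_right (h.norm_jacF_le_CDF hn ?_) (norm_nonneg _))
  have e2 : z + (1 / 2 : ℝ) • (z' - z) = (1 / 2 : ℝ) • z + (1 / 2 : ℝ) • z' := by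
    rw [smul_sub]; module
  rw [e2]
  refine (norm_add_le _ _).trans ?_
  rw [norm_smul, norm_smul, Real.norm_of_nonneg (by norm_num)]
  linarith

end MethodParams.Admissible

end Neighbourhood

end Parameters

/-! ### The exact Newton step on the neighbourhood. -/

section Newton

/-- The left side is four times the positive part of ds·dμ, and 4(μ ds)(s dμ) ≤ (μ ds + s dμ)² = r².
Keeping the signed term allows summation: its total is nonnegative along a Newton step and can be
dropped. -/
lemma two_mul_abs_add_le {s μ ds dμ r q : ℝ} (hq : 0 < q) (hsμ : q ≤ s * μ)
    (h : μ * ds + s * dμ = -r) : 2 * |ds * dμ| + 2 * (ds * dμ) ≤ r ^ 2 / q := by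
  rw [le_div_iff₀ hq]
  rcases le_total 0 (ds * dμ) with h0 | h0
  · rw [abs_of_nonneg h0]
    have h1 : r ^ 2 = (μ * ds + s * dμ) ^ 2 := by rw [h]; ring
    have h2 := mul_le_mul_of_nonneg_left hsμ h0
    nlinarith [sq_nonneg (μ * ds - s * dμ)]
  · rw [abs_of_nonpos h0]
    nlinarith [sq_nonneg r]

/-- The new product is τ + ds·dμ > 0, so the new factors have equal signs; the combination μ(s + ds)
+ s(μ + dμ) = 2τ + r > 0 rules out that both are negative. -/
lemma pos_of_newton {s μ ds dμ r τ : ℝ} (hs : 0 < s) (hμ : 0 < μ) (hr : s * μ = τ + r)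
    (h : μ * ds + s * dμ = -r) (h1 : |r| < τ) (h2 : |ds * dμ| < τ) :
    0 < s + ds ∧ 0 < μ + dμ := by
  have hr1 := abs_lt.1 h1
  have hd1 := abs_lt.1 h2
  have hprod : 0 < (s + ds) * (μ + dμ) := by nlinarith
  have hsum : 0 < μ * (s + ds) + s * (μ + dμ) := by nlinarith
  rcases mul_pos_iff.1 hprod with h3 | h3
  · exact h3
  · nlinarith [mul_neg_of_pos_of_neg hμ h3.1, mul_neg_of_pos_of_neg hs h3.2]

/-- The exact Newton step halves the width of the neighbourhood of the central path. -/
lemma newton_mem_pathNbhd_half {P : ProblemData n m} {ω θ τ : ℝ} {z d : PDSpace n m}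
    (hQ : P.Q.PosSemidef) (hω : 0 < ω) (hθ : 0 < θ) (hθ' : θ ≤ 3 / 10) (hτ : 0 < τ)
    (hz : z ∈ pathNbhd P ω θ τ) (hd : mv (jacF P ω z) d = -optF P ω τ z) :
    z + d ∈ pathNbhd P ω (1 / 2 * θ) τ := by
  obtain ⟨hx0, hl0, hr, hx, hL, hR⟩ := hz
  set rL : Fin n → ℝ := fun i => optF P ω τ z (ixL i) with hrL
  set rR : Fin n → ℝ := fun i => optF P ω τ z (ixR i) with hrR
  set res : EuclideanSpace ℝ (Fin n ⊕ Fin n) := WithLp.toLp 2 (Sum.elim rL rR) with hres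
  have hdx : ∀ i, mv (jacF P ω z) d (ixX i) = 0 := fun i => by
    rw [hd, PiLp.neg_apply, hx0, neg_zero]
  have hdl : ∀ k, mv (jacF P ω z) d (ixLam k) = 0 := fun k => by
    rw [hd, PiLp.neg_apply, hl0, neg_zero]
  have hdL : ∀ i, muLPart z i * xPart d i + (1 + xPart z i) * muLPart d i = -rL i := fun i => by
    rw [← mv_jacF_L P ω z d i, hd, PiLp.neg_apply]
  have hdR : ∀ i, muRPart z i * -xPart d i + (1 - xPart z i) * muRPart d i = -rR i := fun i => by
    rw [mul_neg, ← mv_jacF_R P ω z d i, hd, PiLp.neg_apply]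
  have hs1 : ∀ i, 0 < 1 + xPart z i := fun i => by linarith [(abs_lt.1 (hx i)).1]
  have hs2 : ∀ i, 0 < 1 - xPart z i := fun i => by linarith [(abs_lt.1 (hx i)).2]
  have hLe : ∀ i, (1 + xPart z i) * muLPart z i = τ + rL i := fun i => by
    simp only [hrL, optF_L]; ring
  have hRe : ∀ i, (1 - xPart z i) * muRPart z i = τ + rR i := fun i => by
    simp only [hrR, optF_R]; ring
  have hrLle : ∀ i, |rL i| ≤ θ * τ := fun i => (abs_apply_le_norm res (Sum.inl i)).trans hr
  have hrRle : ∀ i, |rR i| ≤ θ * τ := fun i => (abs_apply_le_norm res (Sum.inr i)).trans hr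
  have hq : 0 < (1 - θ) * τ := mul_pos (by linarith) hτ
  -- The first two rows of the Newton system have zero right-hand side, so the saddle form of d
  -- vanishes and this sum equals its nonnegative quadratic terms.
  have hmono : 0 ≤ ∑ i, (xPart d i * muLPart d i + -xPart d i * muRPart d i) := by
    have h1 := saddle_form_eq (P := P) (ω := ω) (z := z) d
    simp only [hdx, hdl, mul_zero, Finset.sum_const_zero, add_zero] at h1
    have h2 : 0 ≤ xPart d ⬝ᵥ P.Q *ᵥ xPart d := by
      simpa using hQ.dotProduct_mulVec_nonneg (xPart d)
    have h3 : 0 ≤ ω * ∑ i, xPart d i ^ 2 := by positivity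
    have h4 : 0 ≤ ω * ∑ k, lamPart d k ^ 2 := by positivity
    simp only [Finset.sum_add_distrib, neg_mul, Finset.sum_neg_distrib]
    linarith
  set S := ∑ i, |xPart d i * muLPart d i| + ∑ i, |-xPart d i * muRPart d i| with hS
  have hnormres : ∑ i, rL i ^ 2 + ∑ i, rR i ^ 2 ≤ (θ * τ) ^ 2 := by
    have h1 := pow_le_pow_left₀ (norm_nonneg _) hr 2
    rw [EuclideanSpace.norm_sq_eq, Fintype.sum_sum_type] at h1
    simpa [hres] using h1
  have hSle : S ≤ 1 / 2 * θ * τ := by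
    have h1 : 2 * S + 2 * ∑ i, (xPart d i * muLPart d i + -xPart d i * muRPart d i) ≤
        (∑ i, rL i ^ 2 + ∑ i, rR i ^ 2) / ((1 - θ) * τ) := by
      rw [hS, add_div, Finset.sum_div, Finset.sum_div, ← Finset.sum_add_distrib,
        ← Finset.sum_add_distrib, Finset.mul_sum, Finset.mul_sum, ← Finset.sum_add_distrib]
      refine Finset.sum_le_sum fun i _ => ?_
      have t1 := two_mul_abs_add_le hq
        (by rw [hLe]; linarith [(abs_le.1 (hrLle i)).1]) (hdL i)
      have t2 := two_mul_abs_add_le hq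
        (by rw [hRe]; linarith [(abs_le.1 (hrRle i)).1]) (hdR i)
      linarith
    -- This amounts to θ ≤ 1 - θ.
    have h2 : (∑ i, rL i ^ 2 + ∑ i, rR i ^ 2) / ((1 - θ) * τ) ≤ θ * τ := by
      rw [div_le_iff₀ hq]
      refine hnormres.trans ?_
      have : 0 < θ * τ * τ := by positivity
      nlinarith
    linarith
  have hSL : ∀ i, |xPart d i * muLPart d i| ≤ S := fun i => by
    have h1 := Finset.single_le_sum (f := fun i => |xPart d i * muLPart d i|)
      (fun _ _ => abs_nonneg _) (Finset.mem_univ i)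
    have h2 : 0 ≤ ∑ i, |-xPart d i * muRPart d i| := Finset.sum_nonneg fun _ _ => abs_nonneg _
    linarith
  have hSR : ∀ i, |-xPart d i * muRPart d i| ≤ S := fun i => by
    have h1 := Finset.single_le_sum (f := fun i => |-xPart d i * muRPart d i|)
      (fun _ _ => abs_nonneg _) (Finset.mem_univ i)
    have h2 : 0 ≤ ∑ i, |xPart d i * muLPart d i| := Finset.sum_nonneg fun _ _ => abs_nonneg _
    linarith
  have hθτ : θ * τ < τ := by nlinarith
  have hθτ' : 1 / 2 * θ * τ < τ := by nlinarith
  have posL : ∀ i, 0 < 1 + xPart z i + xPart d i ∧ 0 < muLPart z i + muLPart d i := fun i =>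
    pos_of_newton (hs1 i) (hL i) (hLe i) (hdL i) ((hrLle i).trans_lt hθτ)
      (((hSL i).trans hSle).trans_lt hθτ')
  have posR : ∀ i, 0 < 1 - xPart z i + -xPart d i ∧ 0 < muRPart z i + muRPart d i := fun i =>
    pos_of_newton (hs2 i) (hR i) (hRe i) (hdR i) ((hrRle i).trans_lt hθτ)
      (((hSR i).trans hSle).trans_lt hθτ')
  have hneg : ∀ a, optF P ω τ z a + mv (jacF P ω z) d a = 0 := fun a => by
    rw [hd, PiLp.neg_apply, add_neg_cancel]
  refine ⟨fun i => by rw [optF_add_x, hneg], fun k => by rw [optF_add_lam, hneg], ?_,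
    fun i => ?_, fun i => (posL i).2, fun i => (posR i).2⟩
  -- The new residuals are the second-order products alone, and their 2-norm is at most their
  -- 1-norm, which is S.
  · refine (norm_le_sum_abs _).trans (le_trans (le_of_eq ?_) hSle)
    rw [Fintype.sum_sum_type, hS]
    congr 1 <;> refine Finset.sum_congr rfl fun i _ => ?_
    · simp only [Sum.elim_inl, optF_add_L, hneg, zero_add, mul_comm]
    · simp only [Sum.elim_inr, optF_add_R, hneg, zero_sub, mul_comm (muRPart d i), neg_mul]
  · rw [xPart_add, Pi.add_apply, abs_lt]
    have h1 := (posL i).1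
    have h2 := (posR i).1
    constructor <;> linarith

end Newton

/-! ### Rounding errors in sums, Jacobian and residual. -/

section FloatingPoint

variable {u : ℝ}

lemma one_add_pow_sub_one_le (hu : 0 ≤ u) (hu1 : u ≤ 1) (k : ℕ) : (1 + u) ^ k - 1 ≤ u * 2 ^ k := by
  induction k with
  | zero => simpa using hu
  | succ k ih =>
    have h1 : (1 + u) ^ k ≤ 2 ^ k := pow_le_pow_left₀ (by linarith) (by linarith) k
    rw [pow_succ, pow_succ]
    nlinarith

lemma Rounds.abs_le {x y : ℝ} (h : Rounds u x y) (hu1 : u ≤ 1) : |y| ≤ 2 * |x| := by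
  have h1 : |y| ≤ |y - x| + |x| := by simpa using abs_add_le (y - x) x
  have h2 : |y - x| ≤ u * |x| := h
  nlinarith [abs_nonneg x]

lemma FlSum.card_pos {s : Multiset ℝ} {y : ℝ} (h : FlSum u s y) : 1 ≤ s.card := by
  induction h with
  | single x => simp
  | add _ _ _ h1 h2 => rw [Multiset.card_add]; omega

/-- The classical error bound for summation in arbitrary order. -/
lemma FlSum.abs_sub_sum_le {s : Multiset ℝ} {y : ℝ} (hu : 0 ≤ u) (h : FlSum u s y) :
    |y - s.sum| ≤ ((1 + u) ^ s.card - 1) * (s.map abs).sum := by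
  induction h with
  | single x =>
    simp only [Multiset.sum_singleton, sub_self, abs_zero, Multiset.card_singleton, pow_one,
      Multiset.map_singleton]
    have := abs_nonneg x
    nlinarith
  | @add s t a b y hs ht hy ihs iht =>
    rw [Multiset.sum_add, Multiset.card_add, Multiset.map_add, Multiset.sum_add]
    have nonneg : ∀ s : Multiset ℝ, 0 ≤ (s.map abs).sum := fun s =>
      Multiset.sum_nonneg fun x hx => by
        obtain ⟨a, -, rfl⟩ := Multiset.mem_map.1 hx
        exact abs_nonneg a
    set S := (s.map abs).sum
    set T := (t.map abs).sum
    have hS : |s.sum| ≤ S := Multiset.abs_sum_le_sum_abs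
    have hT : |t.sum| ≤ T := Multiset.abs_sum_le_sum_abs
    have hS0 : 0 ≤ S := nonneg s
    have hT0 : 0 ≤ T := nonneg t
    have hsc := hs.card_pos
    have htc := ht.card_pos
    -- Both partial sums are nonempty, so each has at most this many terms; the remaining factor 1 +
    -- u pays for the final addition.
    set E := (1 + u) ^ (s.card + t.card - 1) with hE
    have hEk : (1 + u) ^ (s.card + t.card) = (1 + u) * E := by
      rw [hE, ← pow_succ']; congr 1; omega
    have h1 : (1 + u) ^ s.card ≤ E := pow_le_pow_right₀ (by linarith) (by omega)
    have h2 : (1 + u) ^ t.card ≤ E := pow_le_pow_right₀ (by linarith) (by omega)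
    have ha : |a - s.sum| ≤ (E - 1) * S := ihs.trans (by gcongr)
    have hb : |b - t.sum| ≤ (E - 1) * T := iht.trans (by gcongr)
    have hab : |a + b| ≤ E * (S + T) := by
      have e : a + b = (a - s.sum) + (b - t.sum) + (s.sum + t.sum) := by ring
      rw [e]
      refine (abs_add_three _ _ _).trans ?_
      have := abs_add_le s.sum t.sum
      linarith
    have hy' : |y - (a + b)| ≤ u * |a + b| := hy
    have e : y - (s.sum + t.sum) = (y - (a + b)) + (a - s.sum) + (b - t.sum) := by ring
    rw [e, hEk]
    refine (abs_add_three _ _ _).trans ?_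
    have := mul_le_mul_of_nonneg_left hab hu
    nlinarith

/-- Error of a floating point sum whose summands (first components) are themselves approximations
of exact values (second components). -/
lemma FlSum.abs_sub_sum_le_of_approx {t : Multiset (ℝ × ℝ)} {y M : ℝ} {k : ℕ} (hu : 0 ≤ u)
    (hu1 : u ≤ 1) (hM : 0 ≤ M) (h : FlSum u (t.map Prod.fst) y) (hk : t.card ≤ k)
    (happrox : ∀ x ∈ t, |x.1 - x.2| ≤ 3 * u * M) (hbound : ∀ x ∈ t, |x.2| ≤ M) :
    |y - (t.map Prod.snd).sum| ≤ u * (k * (3 + 4 * 2 ^ k)) * M := by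
  have h1 := h.abs_sub_sum_le hu
  rw [Multiset.card_map, Multiset.map_map] at h1
  have hk' : (t.card : ℝ) ≤ k := by exact_mod_cast hk
  -- A computed summand is at most M + 3uM ≤ 4M, the source of the 4 in the constant; the 3 is the
  -- error of the summands themselves.
  have h2 : (t.map (abs ∘ Prod.fst)).sum ≤ k * (4 * M) := by
    have := Multiset.sum_le_card_nsmul (t.map (abs ∘ Prod.fst)) (4 * M) fun x hx => by
      obtain ⟨a, ha, rfl⟩ := Multiset.mem_map.1 hx
      have e : |a.1| ≤ |a.1 - a.2| + |a.2| := by simpa using abs_add_le (a.1 - a.2) a.2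
      have e1 := happrox a ha
      have e2 := hbound a ha
      simp only [Function.comp]
      nlinarith
    rw [Multiset.card_map, nsmul_eq_mul] at this
    exact this.trans (by gcongr)
  have h3 : |(t.map Prod.fst).sum - (t.map Prod.snd).sum| ≤ k * (3 * u * M) := by
    rw [← Multiset.sum_map_sub]
    refine Multiset.abs_sum_le_sum_abs.trans ?_
    rw [Multiset.map_map]
    have := Multiset.sum_le_card_nsmul (t.map (abs ∘ fun x => x.1 - x.2)) (3 * u * M) fun x hx => by
      obtain ⟨a, ha, rfl⟩ := Multiset.mem_map.1 hx
      exact happrox a ha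
    rw [Multiset.card_map, nsmul_eq_mul] at this
    exact this.trans (by gcongr)
  have h4 : (1 + u) ^ t.card - 1 ≤ u * 2 ^ k := by
    refine le_trans ?_ (one_add_pow_sub_one_le hu hu1 k)
    have : (1 + u) ^ t.card ≤ (1 + u) ^ k := pow_le_pow_right₀ (by linarith) hk
    linarith
  have h5 : ((1 + u) ^ t.card - 1) * (t.map (abs ∘ Prod.fst)).sum ≤ u * 2 ^ k * (k * (4 * M)) :=
    mul_le_mul h4 h2 (Multiset.sum_nonneg fun x hx => by
        obtain ⟨a, -, rfl⟩ := Multiset.mem_map.1 hx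
        exact abs_nonneg a.1) (by positivity)
  have e : y - (t.map Prod.snd).sum = (y - (t.map Prod.fst).sum) +
    ((t.map Prod.fst).sum - (t.map Prod.snd).sum) := by ring
  rw [e]
  refine (abs_add_le _ _).trans ?_
  have e2 : u * (k * (3 + 4 * 2 ^ k)) * M = u * 2 ^ k * (k * (4 * M)) + k * (3 * u * M) := by ring
  linarith

/-- One unit of error comes from storing a, and two from rounding the product, as |a'| ≤ 2|a|. -/
lemma rounds_mul_stored {a a' x y M : ℝ} (hu : 0 ≤ u) (hu1 : u ≤ 1) (ha : Rounds u a a')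
    (hy : Rounds u (a' * x) y) (hM : |a| * |x| ≤ M) : |y - a * x| ≤ 3 * u * M := by
  have h1 := ha.abs_le hu1
  have h2 : |a' - a| ≤ u * |a| := ha
  have h3 : |y - a' * x| ≤ u * |a' * x| := hy
  rw [abs_mul] at h3
  have e : y - a * x = (y - a' * x) + (a' - a) * x := by ring
  rw [e]
  refine (abs_add_le _ _).trans ?_
  rw [abs_mul]
  have h4 := mul_le_mul_of_nonneg_right h1 (abs_nonneg x)
  have h5 := mul_le_mul_of_nonneg_right h2 (abs_nonneg x)
  nlinarith

variable {P P' : ProblemData n m} {ω τ : ℝ} {z : PDSpace n m}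

lemma jacF_stored_sub_le {D : ℝ} (hu : 0 ≤ u) (hP : StoredData u P P') (hQ : ‖P.Q‖ ≤ D)
    (hA : ‖P.A‖ ≤ D) (a b : Idx n m) : |jacF P' ω z a b - jacF P ω z a b| ≤ u * D := by
  have hD : 0 ≤ D := (norm_nonneg _).trans hQ
  have hz : 0 ≤ u * D := by positivity
  have hQ' : ∀ i j, |P'.Q i j - P.Q i j| ≤ u * D := fun i j =>
    (hP.Q i j).trans (mul_le_mul_of_nonneg_left ((abs_entry_le_norm _ _ _).trans hQ) hu)
  have hA' : ∀ i j, |P'.A i j - P.A i j| ≤ u * D := fun i j =>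
    (hP.A i j).trans (mul_le_mul_of_nonneg_left ((abs_entry_le_norm _ _ _).trans hA) hu)
  rcases a with i | i | i | i <;> rcases b with j | j | j | j <;>
    simp only [jacF, Matrix.fromBlocks_apply₁₁, Matrix.fromBlocks_apply₁₂,
      Matrix.fromBlocks_apply₂₁, Matrix.fromBlocks_apply₂₂, Matrix.fromCols_apply_inl,
      Matrix.fromCols_apply_inr, Matrix.fromRows_apply_inl, Matrix.fromRows_apply_inr,
      Matrix.add_apply, Matrix.neg_apply, Matrix.transpose_apply, add_sub_add_right_eq_sub,
      sub_self, abs_zero, hz, hQ', hA']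
  -- Only the block -Aᵀ is left, where the sign has to be moved.
  rw [neg_sub_neg, abs_sub_comm]
  exact hA' _ _

lemma norm_flJac_sub_le [Nonempty (Idx n m)] {D : ℝ} {J : Matrix (Idx n m) (Idx n m) ℝ}
    (hu : 0 ≤ u) (hu1 : u ≤ 1) (hP : StoredData u P P') (hJ : FlJac u P' ω z J)
    (hQ : ‖P.Q‖ ≤ D) (hA : ‖P.A‖ ≤ D) (hG : ‖jacF P ω z‖ ≤ D) :
    ‖J - jacF P ω z‖ ≤ Fintype.card (Idx n m) * (3 * u * D) := by
  have hD : 0 ≤ D := (norm_nonneg _).trans hQ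
  refine norm_le_of_entry_le (by positivity) fun a b => ?_
  have h1 := jacF_stored_sub_le (ω := ω) (z := z) hu hP hQ hA a b
  have h2 : |J a b - jacF P' ω z a b| ≤ u * |jacF P' ω z a b| := hJ a b
  have h3 := (abs_entry_le_norm (jacF P ω z) a b).trans hG
  have h4 : |jacF P' ω z a b| ≤ |jacF P' ω z a b - jacF P ω z a b| + |jacF P ω z a b| := by
    simpa using abs_add_le (jacF P' ω z a b - jacF P ω z a b) (jacF P ω z a b)
  have h5 : |jacF P' ω z a b| ≤ 2 * D := by nlinarith
  have h6 := mul_le_mul_of_nonneg_left h5 hu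
  rw [Matrix.sub_apply]
  have e : J a b - jacF P ω z a b =
    (J a b - jacF P' ω z a b) + (jacF P' ω z a b - jacF P ω z a b) := by ring
  rw [e]
  refine (abs_add_le _ _).trans ?_
  linarith

/-- In units of u·D·Z, the subtraction of τ costs 2, the product 1/2 and the slack 1/4. Replacing x
by -x covers the other complementarity block. -/
lemma rounds_complementarity {x μ s t y D Z : ℝ} (hu : 0 ≤ u) (hu1 : u ≤ 1) (hZ : 1 ≤ Z)
    (hD : 4 + 4 * Z ≤ D) (hx : |x| ≤ Z) (hμ : |μ| ≤ Z) (hτ0 : 0 ≤ τ) (hτ : τ ≤ Z)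
    (hs : Rounds u (1 + x) s) (ht : Rounds u (μ * s) t) (hy : Rounds u (t - τ) y) :
    |y - (μ * (1 + x) - τ)| ≤ 3 * u * (D * Z) := by
  have h1 : |1 + x| ≤ D / 4 := (abs_add_le _ _).trans (by rw [abs_one]; linarith)
  have h2 := hs.abs_le hu1
  have h3 := ht.abs_le hu1
  have hs' : |s - (1 + x)| ≤ u * |1 + x| := hs
  have ht' : |t - μ * s| ≤ u * |μ * s| := ht
  have hy' : |y - (t - τ)| ≤ u * |t - τ| := hy
  have h4 : |μ * s| ≤ D * Z / 2 := by
    rw [abs_mul]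
    have := mul_le_mul hμ (h2.trans (mul_le_mul_of_nonneg_left h1 (by norm_num)))
      (abs_nonneg s) (by linarith)
    linarith
  have hDZ : Z ≤ D * Z := by nlinarith
  have h5 : |t - τ| ≤ 2 * (D * Z) := by
    refine (abs_sub _ _).trans ?_
    rw [abs_of_nonneg hτ0]; linarith
  have h6 : |μ * (s - (1 + x))| ≤ u * (D * Z / 4) := by
    rw [abs_mul]
    have := mul_le_mul hμ (hs'.trans (mul_le_mul_of_nonneg_left h1 hu)) (abs_nonneg _)
      (by linarith)
    linarith
  have e : y - (μ * (1 + x) - τ) = (y - (t - τ)) + (t - μ * s) + μ * (s - (1 + x)) := by ring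
  rw [e]
  refine (abs_add_three _ _ _).trans ?_
  have h7 := mul_le_mul_of_nonneg_left h5 hu
  have h8 := mul_le_mul_of_nonneg_left h4 hu
  have h9 : 0 ≤ u * (D * Z) := by have : 0 ≤ D * Z := by linarith
                                  positivity
  linarith

/-- The constant of the rounding error bound for the evaluation of the residual. -/
def residualConst (n m : ℕ) : ℝ := ((n + m + 4 : ℕ) : ℝ) * (3 + 4 * 2 ^ (n + m + 4))

lemma three_le_residualConst (n m : ℕ) : 3 ≤ residualConst n m := by
  have h1 : (1 : ℝ) ≤ ((n + m + 4 : ℕ) : ℝ) := by exact_mod_cast (by omega)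
  have h2 : (0 : ℝ) ≤ 4 * 2 ^ (n + m + 4) := by positivity
  unfold residualConst
  nlinarith

lemma norm_flResidual_sub_le {D Z : ℝ} {r : PDSpace n m} (hu : 0 ≤ u) (hu1 : u ≤ 1)
    (hZ : 1 ≤ Z) (hD : 4 + 4 * Z ≤ D) (hP : StoredData u P P') (hr : FlResidual u P' ω τ z r)
    (hQ : ‖P.Q‖ ≤ D) (hA : ‖P.A‖ ≤ D) (hc : ‖P.c‖ ≤ Z) (hb : ‖P.b‖ ≤ Z) (hω : |ω| ≤ 1)
    (hz : ‖z‖ ≤ Z) (hτ0 : 0 ≤ τ) (hτ : τ ≤ Z) :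
    ‖r - optF P ω τ z‖ ≤ Fintype.card (Idx n m) * (u * residualConst n m * (D * Z)) := by
  have hres := three_le_residualConst n m
  have hZ0 : 0 ≤ Z := by linarith
  have hD0 : 0 ≤ D := by linarith
  have hM : 0 ≤ D * Z := by positivity
  have hZM : Z ≤ D * Z := by nlinarith
  have hza : ∀ a, |z a| ≤ Z := fun a => (abs_apply_le_norm z a).trans hz
  have hQx : ∀ i j, |P.Q i j| * |xPart z j| ≤ D * Z := fun i j =>
    mul_le_mul ((abs_entry_le_norm _ _ _).trans hQ) (hza _) (abs_nonneg _) hD0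
  have hAx : ∀ k i, ∀ a, |P.A k i| * |z a| ≤ D * Z := fun k i a =>
    mul_le_mul ((abs_entry_le_norm _ _ _).trans hA) (hza _) (abs_nonneg _) hD0
  have hωz : ∀ a, |ω * z a| ≤ D * Z := fun a => by
    rw [abs_mul]
    nlinarith [hza a, abs_nonneg (z a), abs_nonneg ω]
  have hstore : ∀ {a b : ℝ}, Rounds u a b → |a| ≤ D * Z → |b - a| ≤ 3 * u * (D * Z) := by
    intro a b h ha
    have h1 : |b - a| ≤ u * |a| := h
    have h2 := mul_le_mul_of_nonneg_left ha hu
    have h3 : 0 ≤ u * (D * Z) := by positivity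
    linarith
  have hzero : 0 ≤ 3 * u * (D * Z) := by positivity
  have hcM : ∀ i, |P.c i| ≤ D * Z := fun i => (abs_apply_le_norm _ _).trans (hc.trans hZM)
  have hbM : ∀ i, |P.b i| ≤ D * Z := fun i => (abs_apply_le_norm _ _).trans (hb.trans hZM)
  have hLR : 3 * u * (D * Z) ≤ u * residualConst n m * (D * Z) := by
    have : 0 ≤ u * (D * Z) := by positivity
    nlinarith
  refine norm_le_card_mul (by positivity) (forall_idx (fun i => ?_) (fun k => ?_) (fun i => ?_)
    (fun i => ?_))
  · obtain ⟨p, q, w, hp, hq, hw, hsum⟩ := hr.row_x i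
    -- Computed and exact summands are paired in one multiset: the first projection is what the
    -- machine adds up, the second sums to the exact residual. This row has n + m + 4 summands, the
    -- largest number in any row.
    let t : Multiset (ℝ × ℝ) :=
      Finset.univ.val.map (fun j => (p j, P.Q i j * xPart z j)) +
      Finset.univ.val.map (fun k => (-q k, -(P.A k i * lamPart z k))) +
      {(w, ω * xPart z i), (P'.c i, P.c i), (-muLPart z i, -muLPart z i),
        (muRPart z i, muRPart z i)}
    have hfst : t.map Prod.fst = Finset.univ.val.map p + Finset.univ.val.map (fun k => -q k)
        + {w, P'.c i, -muLPart z i, muRPart z i} := by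
      simp only [t, Multiset.map_add, Multiset.map_map, Multiset.insert_eq_cons,
        Multiset.map_cons, Multiset.map_singleton, Function.comp_def]
    have hsnd : (t.map Prod.snd).sum = optF P ω τ z (ixX i) := by
      simp only [t, Multiset.map_add, Multiset.map_map, Multiset.insert_eq_cons,
        Multiset.map_cons, Multiset.map_singleton, Function.comp_def, Multiset.sum_add,
        Multiset.sum_cons, Multiset.sum_singleton, optF_x, Matrix.mulVec, dotProduct,
        Matrix.transpose_apply, Finset.sum_map_val, Finset.sum_neg_distrib]
      ring
    have hcard : t.card ≤ n + m + 4 := by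
      simp [t]
    have key : ∀ x ∈ t, |x.1 - x.2| ≤ 3 * u * (D * Z) ∧ |x.2| ≤ D * Z := by
      intro x hx
      simp only [t, Multiset.mem_add, Multiset.mem_map, Finset.mem_val, Finset.mem_univ, true_and,
        Multiset.insert_eq_cons, Multiset.mem_cons, Multiset.mem_singleton] at hx
      rcases hx with (⟨j, rfl⟩ | ⟨k, rfl⟩) | rfl | rfl | rfl | rfl
      · exact ⟨rounds_mul_stored hu hu1 (hP.Q i j) (hp j) (hQx i j),
          by rw [abs_mul]; exact hQx i j⟩
      · refine ⟨?_, by rw [abs_neg, abs_mul]; exact hAx k i _⟩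
        rw [neg_sub_neg, abs_sub_comm]
        exact rounds_mul_stored hu hu1 (hP.A k i) (hq k) (hAx k i _)
      · exact ⟨hstore hw (hωz _), hωz _⟩
      · exact ⟨hstore (hP.c i) (hcM i), hcM i⟩
      · exact ⟨by simpa using hzero, by rw [abs_neg]; exact (hza _).trans hZM⟩
      · exact ⟨by simpa using hzero, (hza _).trans hZM⟩
    rw [← hfst] at hsum
    have := hsum.abs_sub_sum_le_of_approx hu hu1 hM hcard (fun x hx => (key x hx).1)
      (fun x hx => (key x hx).2)
    rw [hsnd] at this
    exact this
  · obtain ⟨p, w, hp, hw, hsum⟩ := hr.row_lam k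
    let t : Multiset (ℝ × ℝ) :=
      Finset.univ.val.map (fun j => (p j, P.A k j * xPart z j)) +
      {(w, ω * lamPart z k), (-P'.b k, -P.b k)}
    have hfst : t.map Prod.fst = Finset.univ.val.map p + {w, -P'.b k} := by
      simp only [t, Multiset.map_add, Multiset.map_map, Multiset.insert_eq_cons,
        Multiset.map_cons, Multiset.map_singleton, Function.comp_def]
    have hsnd : (t.map Prod.snd).sum = optF P ω τ z (ixLam k) := by
      simp only [t, Multiset.map_add, Multiset.map_map, Multiset.insert_eq_cons,
        Multiset.map_cons, Multiset.map_singleton, Function.comp_def, Multiset.sum_add,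
        Multiset.sum_cons, Multiset.sum_singleton, optF_lam, Matrix.mulVec, dotProduct,
        Finset.sum_map_val]
      ring
    have hcard : t.card ≤ n + m + 4 := by
      simp [t]; omega
    have key : ∀ x ∈ t, |x.1 - x.2| ≤ 3 * u * (D * Z) ∧ |x.2| ≤ D * Z := by
      intro x hx
      simp only [t, Multiset.mem_add, Multiset.mem_map, Finset.mem_val, Finset.mem_univ, true_and,
        Multiset.insert_eq_cons, Multiset.mem_cons, Multiset.mem_singleton] at hx
      rcases hx with ⟨j, rfl⟩ | rfl | rfl
      · exact ⟨rounds_mul_stored hu hu1 (hP.A k j) (hp j) (hAx k j _),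
          by rw [abs_mul]; exact hAx k j _⟩
      · exact ⟨hstore hw (hωz _), hωz _⟩
      · refine ⟨?_, by rw [abs_neg]; exact hbM k⟩
        rw [neg_sub_neg, abs_sub_comm]
        exact hstore (hP.b k) (hbM k)
    rw [← hfst] at hsum
    have := hsum.abs_sub_sum_le_of_approx hu hu1 hM hcard (fun x hx => (key x hx).1)
      (fun x hx => (key x hx).2)
    rw [hsnd] at this
    exact this
  · obtain ⟨s, t, hs, ht, hy⟩ := hr.row_L i
    exact (rounds_complementarity hu hu1 hZ hD (hza _) (hza _) hτ0 hτ hs ht hy).trans hLR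
  · obtain ⟨s, t, hs, ht, hy⟩ := hr.row_R i
    rw [sub_eq_add_neg] at hs
    have := rounds_complementarity hu hu1 hZ hD (by rw [abs_neg]; exact hza _) (hza _) hτ0 hτ
      hs ht hy
    rw [← sub_eq_add_neg] at this
    exact this.trans hLR

end FloatingPoint

/-! ### Error of the computed Newton step. -/

section Step

/-- The constant of the rounding error bound for the Newton step. -/
def stepConst (n m : ℕ) (γ : ℝ) : ℝ :=
  18 * Fintype.card (Idx n m) + 2 * (Fintype.card (Idx n m) * residualConst n m) + 24 * |γ| + 9

lemma stepConst_pos (n m : ℕ) (γ : ℝ) : 0 < stepConst n m γ := by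
  have := three_le_residualConst n m
  unfold stepConst
  positivity

/-- Solving a perturbed system: a vector that solves the system up to small errors in the matrix
and in the right-hand side is close to the exact solution. -/
lemma norm_sub_le_of_perturbed_solve {ι : Type*} [Fintype ι] [DecidableEq ι]
    {G J δG : Matrix ι ι ℝ} {f r δv y d : EuclideanSpace ℝ ι} {K a b R : ℝ} (hK : 0 ≤ K)
    (hG : ∀ v, ‖v‖ ≤ K * ‖mv G v‖) (hJ : ‖J - G‖ ≤ a) (hδG : ‖δG‖ ≤ b)
    (hab : K * (a + b) ≤ 1 / 2) (hr : ‖r - f‖ + ‖δv‖ ≤ R) (hd : mv G d = -f)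
    (hy : mv (J + δG) y = -r + δv) : ‖y - d‖ ≤ 2 * (K * (R + (a + b) * ‖d‖)) := by
  have e : mv G (y - d) = -(r - f) + δv - mv (J - G) y - mv δG y := by
    rw [mv_add_left] at hy
    rw [mv_sub, hd, mv_sub_left, eq_sub_of_add_eq hy]
    abel
  have h1 : ‖mv G (y - d)‖ ≤ R + (a + b) * ‖y‖ := by
    rw [e]
    have t1 := norm_sub_le (-(r - f) + δv - mv (J - G) y) (mv δG y)
    have t2 := norm_sub_le (-(r - f) + δv) (mv (J - G) y)
    have t3 := norm_add_le (-(r - f)) δv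
    rw [norm_neg] at t3
    have t4 := (norm_mv_le (J - G) y).trans (mul_le_mul_of_nonneg_right hJ (norm_nonneg y))
    have t5 := (norm_mv_le δG y).trans (mul_le_mul_of_nonneg_right hδG (norm_nonneg y))
    linarith
  have hab0 : 0 ≤ a + b := add_nonneg ((norm_nonneg _).trans hJ) ((norm_nonneg _).trans hδG)
  have h2 : ‖y‖ ≤ ‖y - d‖ + ‖d‖ := by simpa using norm_add_le (y - d) d
  have h3 := (hG (y - d)).trans (mul_le_mul_of_nonneg_left
    (h1.trans (add_le_add_right (mul_le_mul_of_nonneg_left h2 hab0) R)) hK)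
  -- The contribution of y - d on the right is at most half of ‖y - d‖ and is absorbed on the left,
  -- which gives the factor 2.
  have h4 := mul_le_mul_of_nonneg_right hab (norm_nonneg (y - d))
  linarith

/-- The rounding error of a Newton step, relative to the exact Newton step. -/
lemma norm_flNewtonStep_sub_le [Nonempty (Idx n m)] {γ u ω τ K D Z : ℝ} {P : ProblemData n m}
    {z z' d : PDSpace n m} {solve : LinSolver n m} (hsolve : solve.IsStable γ) (hu : 0 < u)
    (hG : ∀ v, ‖v‖ ≤ K * ‖mv (jacF P ω z) v‖) (hGD : ‖jacF P ω z‖ ≤ D) (hKD : 1 ≤ D * K)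
    (hZ : 1 ≤ Z) (hD : 4 + 4 * Z ≤ D) (hQ : ‖P.Q‖ ≤ D) (hA : ‖P.A‖ ≤ D) (hc : ‖P.c‖ ≤ Z)
    (hb : ‖P.b‖ ≤ Z) (hω : |ω| ≤ 1) (hz : ‖z‖ ≤ Z) (hτ0 : 0 ≤ τ) (hτ : τ ≤ Z)
    (hd : mv (jacF P ω z) d = -optF P ω τ z) (hdZ : ‖d‖ ≤ 3 * Z)
    (hsmall : stepConst n m γ * u * (D * K) ≤ 1 / 4)
    (hstep : FlNewtonStep solve u P ω τ z z') :
    ‖z' - (z + d)‖ ≤ stepConst n m γ * u * (D * K) * Z := by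
  obtain ⟨P', J, r, hP, hJ, hr, hz'⟩ := hstep
  have hD0 : 0 < D := by linarith
  have hK0 : 0 < K := by
    by_contra hK
    nlinarith [mul_nonpos_of_nonneg_of_nonpos hD0.le (not_lt.1 hK)]
  have hZ0 : 0 < Z := by linarith
  set N : ℝ := ((Fintype.card (Idx n m) : ℕ) : ℝ) with hN
  set ρ : ℝ := N * residualConst n m with hρ
  set g : ℝ := |γ| with hg
  have hg0 : 0 ≤ g := abs_nonneg γ
  have hN0 : 0 ≤ N := by positivity
  have hρ0 : 0 ≤ ρ := mul_nonneg hN0 (by linarith [three_le_residualConst n m])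
  -- In units of q·Z: 18N comes from the Jacobian error acting on ‖d‖ ≤ 3Z, 2ρ from the residual,
  -- 20g from the solver's backward error, 4g from its forward error, and 9 from rounding z + Δz.
  have hC : stepConst n m γ = 18 * N + 2 * ρ + 24 * g + 9 := rfl
  set q : ℝ := u * (D * K) with hq
  have hq0 : 0 < q := by positivity
  have huq : u ≤ q := le_mul_of_one_le_right hu.le hKD
  rw [hC, mul_assoc] at hsmall
  have hNq : 0 ≤ N * q := by positivity
  have hρq : 0 ≤ ρ * q := by positivity
  have hgq : 0 ≤ g * q := by positivity
  have hu1 : u ≤ 1 := by linarith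
  have hρu : ρ * u ≤ 1 := (mul_le_mul_of_nonneg_left huq hρ0).trans (by linarith)
  have hNu : 3 * N * u ≤ 1 := (mul_le_mul_of_nonneg_left huq (by positivity)).trans (by linarith)
  have hgu : g * u ≤ g * q := mul_le_mul_of_nonneg_left huq hg0
  have hgu1 : g * u ≤ 1 := hgu.trans (by linarith)
  have hgu0 : 0 ≤ g * u := by positivity
  have hJG : ‖J - jacF P ω z‖ ≤ 3 * N * u * D := by
    have := norm_flJac_sub_le hu.le hu1 hP hJ hQ hA hGD
    linarith
  have hrF : ‖r - optF P ω τ z‖ ≤ ρ * u * (D * Z) := by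
    have := norm_flResidual_sub_le hu.le hu1 hZ hD hP hr hQ hA hc hb hω hz hτ0 hτ
    rw [hρ]; linarith
  have hKJ : K * ‖J - jacF P ω z‖ ≤ 1 / 2 := by
    refine (mul_le_mul_of_nonneg_left hJG hK0.le).trans ?_
    have e : K * (3 * N * u * D) = 3 * (N * q) := by rw [hq]; ring
    rw [e]; linarith
  obtain ⟨hJu, hJinv⟩ := isUnit_det_of_bounded_below (by positivity)
    (bounded_below_perturb hK0.le hG hKJ)
  have hJD : ‖J‖ ≤ 2 * D := by
    have h1 : ‖J‖ ≤ ‖J - jacF P ω z‖ + ‖jacF P ω z‖ := by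
      simpa using norm_add_le (J - jacF P ω z) (jacF P ω z)
    have h2 := mul_le_mul_of_nonneg_right hNu hD0.le
    linarith
  -- The stability guarantee applies only to such systems; the perturbed matrix at most doubles both
  -- D and K.
  have hcond : γ * u * (‖J‖ * ‖J⁻¹‖) < 1 := by
    have h1 : ‖J‖ * ‖J⁻¹‖ ≤ 2 * D * (2 * K) :=
      mul_le_mul hJD hJinv (norm_nonneg _) (by positivity)
    have h2 : γ * u ≤ g * u := mul_le_mul_of_nonneg_right (le_abs_self γ) hu.le
    have h3 : γ * u * (‖J‖ * ‖J⁻¹‖) ≤ g * u * (2 * D * (2 * K)) :=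
      mul_le_mul h2 h1 (by positivity) hgu0
    have e : g * u * (2 * D * (2 * K)) = 4 * (g * q) := by rw [hq]; ring
    rw [e] at h3
    linarith
  obtain ⟨δG, δv, y, hδG, hδv, hy, hsol⟩ := hsolve u J (-r) hu hJu hcond
  have hγg : ∀ x : ℝ, 0 ≤ x → γ * u * x ≤ g * u * x := fun x hx =>
    mul_le_mul_of_nonneg_right (mul_le_mul_of_nonneg_right (le_abs_self γ) hu.le) hx
  have hδG' : ‖δG‖ ≤ 2 * g * u * D := by
    have h1 := hδG.trans (hγg _ (norm_nonneg J))
    have h2 := mul_le_mul_of_nonneg_left hJD hgu0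
    linarith
  have hF : ‖optF P ω τ z‖ ≤ 3 * (D * Z) := by
    rw [← norm_neg, ← hd]
    refine (norm_mv_le _ _).trans ((mul_le_mul hGD hdZ (norm_nonneg _) hD0.le).trans ?_)
    linarith
  have hDZ : 0 ≤ D * Z := by positivity
  have hrn : ‖r‖ ≤ 4 * (D * Z) := by
    have h1 : ‖r‖ ≤ ‖r - optF P ω τ z‖ + ‖optF P ω τ z‖ := by
      simpa using norm_add_le (r - optF P ω τ z) (optF P ω τ z)
    have h2 := mul_le_mul_of_nonneg_right hρu hDZ
    linarith
  have hδv' : ‖δv‖ ≤ 4 * g * u * (D * Z) := by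
    rw [norm_neg] at hδv
    have h1 := hδv.trans (hγg _ (norm_nonneg r))
    have h2 := mul_le_mul_of_nonneg_left hrn hgu0
    linarith
  have hy' : mv (J + δG) y = -r + δv := by
    ext a; exact congrFun hy a
  have hyd := norm_sub_le_of_perturbed_solve hK0.le hG hJG hδG'
    (by
      have e : K * (3 * N * u * D + 2 * g * u * D) = 3 * (N * q) + 2 * (g * q) := by
        rw [hq]; ring
      rw [e]; linarith)
    (add_le_add hrF hδv') hd hy'
  have hydq : ‖y - d‖ ≤ (2 * ρ + 18 * N + 20 * g) * q * Z := by
    refine hyd.trans ?_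
    have h1 : (3 * N * u * D + 2 * g * u * D) * ‖d‖ ≤
        (3 * N * u * D + 2 * g * u * D) * (3 * Z) :=
      mul_le_mul_of_nonneg_left hdZ (by positivity)
    have h2 : 2 * (K * (ρ * u * (D * Z) + 4 * g * u * (D * Z) +
        (3 * N * u * D + 2 * g * u * D) * (3 * Z))) = (2 * ρ + 18 * N + 20 * g) * q * Z := by
      rw [hq]; ring
    rw [← h2]
    gcongr
  have hydZ : ‖y - d‖ ≤ Z := by
    refine hydq.trans (mul_le_of_le_one_left hZ0.le ?_)
    linarith
  have hyn : ‖y‖ ≤ 4 * Z := by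
    have : ‖y‖ ≤ ‖y - d‖ + ‖d‖ := by simpa using norm_add_le (y - d) d
    linarith
  set s := solve u J (-r) with hs
  have hsy : ‖s - y‖ ≤ 4 * g * q * Z := by
    have h1 := hsol.trans (hγg _ (norm_nonneg y))
    have h2 := mul_le_mul_of_nonneg_left hyn hgu0
    have h3 := mul_le_mul_of_nonneg_right hgu hZ0.le
    linarith
  have hsn : ‖s‖ ≤ 8 * Z := by
    have h1 : ‖s‖ ≤ ‖s - y‖ + ‖y‖ := by simpa using norm_add_le (s - y) y
    have h2 : 4 * g * q * Z ≤ 4 * Z := by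
      refine mul_le_mul_of_nonneg_right ?_ hZ0.le
      linarith
    linarith
  have hround : ‖z' - (z + s)‖ ≤ 9 * q * Z := by
    have h1 : ‖z' - (z + s)‖ ≤ u * ‖z + s‖ := norm_le_mul_of_abs_le hu.le hz'
    have h2 : ‖z + s‖ ≤ 9 * Z := (norm_add_le _ _).trans (by linarith)
    have h3 := mul_le_mul huq h2 (norm_nonneg _) hq0.le
    linarith
  have e : z' - (z + d) = (z' - (z + s)) + (s - y) + (y - d) := by abel
  rw [e]
  refine (norm_add₃_le).trans ?_
  rw [hC, mul_assoc _ u, ← hq]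
  linarith

end Step

end BoxQP

end

/-! ### Assembly of the error budget. -/

theorem mainTheorem5 (n m : ℕ) (hn : 1 ≤ n) (γ : ℝ) :
    ∃ C : ℝ, 0 < C ∧
      ∀ (P : BoxQP.ProblemData n m) (tol : ℝ) (p : BoxQP.MethodParams),
        P.Q.PosSemidef → 0 < tol → p.Admissible P tol →
        ∀ (solve : BoxQP.LinSolver n m), solve.IsStable γ →
        ∀ εmach : ℝ, 0 < εmach → C * εmach ≤ p.ν₀ / (4 * p.Cz * p.κDF) →
        ∀ τ ∈ Set.Icc (p.σ * p.τE) (p.σ * p.τA),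
        ∀ z ∈ BoxQP.envN P p τ p.ν₁,
          IsUnit (BoxQP.jacF P p.ω z).det ∧
          ∀ z' : BoxQP.PDSpace n m,
            BoxQP.FlNewtonStep solve εmach P p.ω τ z z' → z' ∈ BoxQP.envNh P p τ p.ν₂ := by
  open BoxQP in
  refine ⟨stepConst n m γ, stepConst_pos n m γ, ?_⟩
  rintro P tol p hQ - h solve hsolve u hu hC τ ⟨hτE, hτA⟩ z ⟨z₀, hz₀, hzz₀⟩
  have : Nonempty (Idx n m) := ⟨ixX ⟨0, hn⟩⟩
  have hτ0 : 0 < τ := (mul_pos (h.σ_pos hn) h.τE_pos).trans_le hτE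
  have hZ := h.one_le_Cz hn
  have hD := h.CDF_ge'
  have hω0 := h.ω_pos
  have hω1 := h.ω_le_one
  have hK0 := h.CDFinv_pos
  have hnQ := norm_nonneg P.Q
  have hnA := norm_nonneg P.A
  set Z := p.Cz
  set D := p.CDF
  set K := p.CDFinv
  have hz₀Z : ‖z₀‖ ≤ Z - 1 / 10 := h.norm_le_of_mem hz₀ le_rfl hτ0.le hτA
  have hD4 : 4 ≤ D := by linarith
  have below₀ : ∀ v, ‖v‖ ≤ K * ‖mv (jacF P p.ω z₀) v‖ :=
    h.jacF_bounded_below_of_near hn hQ hz₀ le_rfl hτE hτA (by simpa using h.cGap_pos.le)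
      (by linarith)
  -- A condition number is at least 1, tested on a unit vector.
  have hDK : 1 ≤ D * K := by
    have h1 := below₀ (EuclideanSpace.single (ixX ⟨0, hn⟩) 1)
    have h2 := norm_mv_le (jacF P p.ω z₀) (EuclideanSpace.single (ixX ⟨0, hn⟩) 1)
    rw [PiLp.norm_single, norm_one] at h1 h2
    have h3 := h.norm_jacF_le_CDF hn (z := z₀) (by linarith)
    have h4 : ‖mv (jacF P p.ω z₀) (EuclideanSpace.single (ixX ⟨0, hn⟩) 1)‖ ≤ D := by linarith
    linarith [mul_le_mul_of_nonneg_left h4 hK0.le]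
  have hκ : D * K ≤ p.κDF := h.κDF_ge
  -- This is twice the amplification factor of `hhalf`, so that ν₁ ≤ ν₂/Cν yields ν₂/2 there.
  have hCν : 2 + 2 * (D * K) + 8 * (K * Z) ≤ p.Cν := by
    refine le_trans ?_ ((le_max_left _ _).trans h.Cν_ge)
    have hδF : D ≤ p.CδF := h.CδF_ge
    have hδDF := h.CδDF_ge
    have hδΔ : 2 * (D * K) ≤ p.CδΔz := by linarith [h.CδΔz_ge]
    have h1 : D * K ≤ p.CδF * K := mul_le_mul_of_nonneg_right hδF hK0.le
    have h2 : (2 : ℝ) ≤ 2 / p.ω := by rw [le_div_iff₀ hω0]; linarith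
    have h3 : (4 : ℝ) ≤ 2 / p.ω * p.CδDF := by nlinarith
    have h4 : 4 * Z ≤ 2 / p.ω * p.CδDF * Z := mul_le_mul_of_nonneg_right h3 (by linarith)
    have h5 : 4 * (D * K) * (D * K + 4 * Z) ≤
        2 * p.CδΔz * (p.CδF * K + 2 / p.ω * p.CδDF * Z) :=
      mul_le_mul (by linarith) (by linarith) (by nlinarith) (by linarith)
    refine le_trans ?_ h5
    have h6 : K * Z ≤ D * K * Z := by
      have : 0 ≤ K * Z := by positivity
      nlinarith
    nlinarith
  have hCν1 : 1 ≤ p.Cν := by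
    have : 0 < K * Z := by positivity
    linarith
  have hCν0 : 0 < p.Cν := by linarith
  have hν1 : p.ν₁ * p.Cν ≤ p.ν₂ := (le_div_iff₀ hCν0).1 h.ν₁_le
  have hν2 : p.ν₂ ≤ 1 / 10 := h.ν₂_le.trans ((min_le_left _ _).trans (min_le_left _ _))
  have hν2g : p.ν₂ * p.Cν ≤ p.cGap := (le_div_iff₀ hCν0).1
    (h.ν₂_le.trans ((min_le_left _ _).trans (min_le_right _ _)))
  have hν0 : p.ν₀ * p.Cν ≤ p.ν₁ := (le_div_iff₀ hCν0).1 (h.ν₀_le.trans (min_le_left _ _))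
  have hν1p := h.ν₁_pos
  have hν2p := h.ν₂_pos
  have hν0p := h.ν₀_pos
  have hν12 : p.ν₁ ≤ p.ν₂ := (le_mul_of_one_le_right hν1p.le hCν1).trans hν1
  have hν01 : p.ν₀ ≤ p.ν₁ := (le_mul_of_one_le_right hν0p.le hCν1).trans hν0
  have hν2g' : p.ν₂ ≤ p.cGap := (le_mul_of_one_le_right hν2p.le hCν1).trans hν2g
  have hzZ : ‖z‖ ≤ Z := by
    have : ‖z‖ ≤ ‖z - z₀‖ + ‖z₀‖ := by simpa using norm_add_le (z - z₀) z₀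
    linarith
  have below : ∀ v, ‖v‖ ≤ K * ‖mv (jacF P p.ω z) v‖ :=
    h.jacF_bounded_below_of_near hn hQ hz₀ le_rfl hτE hτA (by linarith) hzZ
  have hdet := (isUnit_det_of_bounded_below hK0.le below).1
  refine ⟨hdet, fun z' hstep => ?_⟩
  have exact_step : ∀ y, IsUnit (jacF P p.ω y).det →
      ∃ d, mv (jacF P p.ω y) d = -optF P p.ω τ y := fun y hy =>
    ⟨mv (jacF P p.ω y)⁻¹ (-optF P p.ω τ y), by
      ext i; simp [mv, Matrix.mulVec_mulVec, Matrix.mul_nonsing_inv _ hy]⟩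
  obtain ⟨d₀, hd₀⟩ := exact_step z₀ (isUnit_det_of_bounded_below hK0.le below₀).1
  obtain ⟨d, hd⟩ := exact_step z hdet
  have hnew := newton_mem_pathNbhd_half hQ hω0 h.θ_pos h.θ_le hτ0 hz₀ hd₀
  have hnewZ : ‖z₀ + d₀‖ ≤ Z - 1 / 10 :=
    h.norm_le_of_mem hnew (by linarith [h.θ_pos]) hτ0.le hτA
  have hd₀Z : ‖d₀‖ ≤ 2 * Z := by
    have : ‖d₀‖ ≤ ‖z₀ + d₀‖ + ‖z₀‖ := by simpa using norm_sub_le (z₀ + d₀) z₀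
    linarith
  -- Subtracting the two Newton systems gives DF(z)(d - d₀) in terms of the increments of F_τ and of
  -- DF, the latter applied to d₀ with ‖d₀‖ ≤ 2Z.
  have hdd₀ : ‖d - d₀‖ ≤ p.ν₁ * (D * K + 4 * (K * Z)) := by
    have e : mv (jacF P p.ω z) (d - d₀) = -(optF P p.ω τ z - optF P p.ω τ z₀) -
        mv (jacF P p.ω z - jacF P p.ω z₀) d₀ := by
      rw [mv_sub, mv_sub_left, hd, hd₀]; abel
    have h1 := h.norm_optF_sub_le hn (τ := τ) (z := z₀) (z' := z) (by linarith) hzZ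
    have h2 := norm_mv_jacF_sub_le (P := P) (ω := p.ω) (z := z₀) z d₀
    have h3 : ‖mv (jacF P p.ω z) (d - d₀)‖ ≤ D * p.ν₁ + 2 * p.ν₁ * (2 * Z) := by
      rw [e]
      refine (norm_sub_le _ _).trans ?_
      rw [norm_neg]
      refine add_le_add (h1.trans (mul_le_mul_of_nonneg_left hzz₀ (by linarith)))
        (h2.trans (mul_le_mul (by linarith) hd₀Z (norm_nonneg _) (by linarith)))
    have h4 := (below (d - d₀)).trans (mul_le_mul_of_nonneg_left h3 hK0.le)
    linarith
  have hhalf : p.ν₁ * (1 + D * K + 4 * (K * Z)) ≤ p.ν₂ / 2 := by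
    have := mul_le_mul_of_nonneg_left hCν hν1p.le
    linarith
  have hdZ : ‖d‖ ≤ 3 * Z := by
    have : ‖d‖ ≤ ‖d - d₀‖ + ‖d₀‖ := by simpa using norm_add_le (d - d₀) d₀
    linarith
  -- Hence the rounding error is at most ν₀/4; with Z ≥ 1 and ν₀ ≤ 1/10 this also supplies the
  -- smallness required by the rounding lemma.
  have hCκ : stepConst n m γ * u * (D * K) * (4 * Z) ≤ p.ν₀ := by
    have h0 : 0 < stepConst n m γ * u := mul_pos (stepConst_pos n m γ) hu
    have h1 : 0 < 4 * Z * p.κDF := by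
      have : 0 < p.κDF := by linarith
      positivity
    have h2 := (le_div_iff₀ h1).1 hC
    have h3 := mul_le_mul_of_nonneg_left hκ (by positivity : 0 ≤ stepConst n m γ * u * (4 * Z))
    linarith
  have hCκ0 : 0 ≤ stepConst n m γ * u * (D * K) :=
    mul_nonneg (mul_pos (stepConst_pos n m γ) hu).le (by linarith)
  have hfl := norm_flNewtonStep_sub_le hsolve hu below (h.norm_jacF_le_CDF hn hzZ) hDK hZ
    (by linarith) (by linarith) (by linarith) (h.norm_c_le hn) h.norm_b_le
    (by rw [abs_of_pos hω0]; exact hω1) hzZ hτ0.le (h.τ_le_Cz hn hτA) hd hdZ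
    (by nlinarith) hstep
  -- The nearby point of 𝒩_h is the exact Newton iterate of z₀. The distance splits into rounding
  -- error, ‖z - z₀‖ ≤ ν₁ and the difference of the exact steps.
  refine ⟨z₀ + d₀, hnew, ?_⟩
  have e : z' - (z₀ + d₀) = (z' - (z + d)) + (z - z₀) + (d - d₀) := by abel
  rw [e]
  refine norm_add₃_le.trans ?_
  linarith
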